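/- Let $f(x,y)$ be a real polynomial all of whose real critical points are isolated. Let $i$ be the index of $\operatorname{grad} f$ around a circle $C$ centered at the origin and containing all critical points in its interior, that is, the degree of the map $C\to S^1$, $q\mapsto \operatorname{grad} f(q)/|\operatorname{grad} f(q)|$, with $C$ oriented counterclockwise (it is the same for all such $C$). Let $\mathbf L$ be the line at infinity of the real projective plane $\mathbf P^2\supset\mathbf R^2$. To a point $q$ outside the critical set where the level curve of $f$ through $q$ is tangent to the circle $C_q$ about the origin through $q$, assign the number $-1/2$ if the level curve lies outside $C_q$ near $q$ (apart from $q$), $+1/2$ if it lies inside $C_q$ near $q$ (apart from $q$), and $0$ otherwise. These points lie on the curve of tangencies $\{x f_y-y f_x=0\}$. For $R>0$ the *ends* are the connected components $\gamma$ of $\{x f_y-y f_x=0\}\cap\{|q|>R\}$. For all sufficiently large $R$: the critical points lie in $\{|q|<R\}$; there are finitely many ends, and each is unbounded; the number assigned to $q$ has a constant value $i(\gamma)\in\{\pm\frac12,0\}$ along each end $\gamma$; and $f(q)$ has a limit $c(\gamma)\in\mathbf R\cup\{\infty\}$ as $q$ goes to infinity along $\gamma$. If moreover the polynomial $x f_y-y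 f_x$ is not zero, each end meets every circle $|q|=r$, $r>R$, in exactly one point and tends in $\mathbf P^2$ to a point $p(\gamma)\in\mathbf L$. (If $x f_y-y f_x$ is the zero polynomial, i.e. $f$ is a polynomial in $x^2+y^2$, the only end is $\{|q|>R\}$, which has no endpoint on $\mathbf L$ and enters none of the sums below.) For $p\in\mathbf L$ and $c\in\mathbf R\cup\{\infty\}$ let $$i_{p,c}=\sum_{\gamma:\ p(\gamma)=p,\ c(\gamma)=c} i(\gamma),\qquad i_{\mathbf L,\infty}=\sum_{p\in\mathbf L} i_{p,\infty}.$$ For large $R$ these numbers do not depend on $R$, only finitely many of them are nonzero, and $$i = 1+\sum_{p\in\mathbf L,\ c\in\mathbf R} i_{p,c}+i_{\mathbf L,\infty}.$$ -/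

import Mathlib

open Filter Topology Bornology MvPolynomial

noncomputable section

/-- The Euclidean plane. -/
abbrev Plane : Type := EuclideanSpace ℝ (Fin 2)

/-- The value of the real polynomial `f(x, y)` at a point of the plane. -/
def polyVal (f : MvPolynomial (Fin 2) ℝ) (q : Plane) : ℝ :=
  MvPolynomial.eval (fun k => q k) f

/-- The gradient vector `(f_x, f_y)` at a point of the plane. -/
def gradAt (f : MvPolynomial (Fin 2) ℝ) (q : Plane) : Plane :=
  !₂[polyVal (pderiv 0 f) q, polyVal (pderiv 1 f) q]

/-- The set of (real) critical points of `f`. -/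
def critSet (f : MvPolynomial (Fin 2) ℝ) : Set Plane :=
  {q | gradAt f q = 0}

/-- Every critical point of `f` has a neighbourhood that contains no other critical point. -/
def HasIsolatedCriticalPoints (f : MvPolynomial (Fin 2) ℝ) : Prop :=
  ∀ q ∈ critSet f, ∀ᶠ q' in 𝓝[≠] q, q' ∉ critSet f

/-! ### The index of the gradient vector field around a circle -/

/-- The counterclockwise parametrization of the circle of radius `ρ` about the origin. -/
def circlePoint (ρ t : ℝ) : Plane :=
  !₂[ρ * Real.cos t, ρ * Real.sin t]

/-- `n` is the degree of the map from the circle of radius `ρ` to the unit circle given by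
`grad f / |grad f|`: the gradient does not vanish on the circle, and a continuous choice `θ` of the
angle of the gradient increases by `2πn` when the circle is traversed once, counterclockwise. -/
def HasGradIndex (f : MvPolynomial (Fin 2) ℝ) (ρ : ℝ) (n : ℤ) : Prop :=
  (∀ t : ℝ, gradAt f (circlePoint ρ t) ≠ 0) ∧
  ∃ θ : ℝ → ℝ, Continuous θ ∧
    (∀ t : ℝ, gradAt f (circlePoint ρ t) =
      ‖gradAt f (circlePoint ρ t)‖ • !₂[Real.cos (θ t), Real.sin (θ t)]) ∧
    θ (2 * Real.pi) - θ 0 = 2 * Real.pi * n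

/-! ### The real projective plane and its line at infinity -/

/-- The real projective plane. -/
abbrev RP2 : Type := Projectivization ℝ (Fin 3 → ℝ)

/-- The projective plane carries the quotient topology from `ℝ³ ∖ {0}`. -/
instance RP2.instTopologicalSpace : TopologicalSpace RP2 :=
  TopologicalSpace.coinduced (Projectivization.mk' ℝ (V := Fin 3 → ℝ)) inferInstance

/-- The embedding `(x, y) ↦ [x, y, 1]` of the plane in the projective plane. -/
def toRP2 (q : Plane) : RP2 :=
  Projectivization.mk ℝ ![q 0, q 1, 1] (fun h => one_ne_zero (congrFun h 2))

/-- The line at infinity `z = 0`. -/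
def lineAtInfinity : Set RP2 :=
  {p | ∃ (a b : ℝ) (h : ![a, b, 0] ≠ (0 : Fin 3 → ℝ)), p = Projectivization.mk ℝ ![a, b, 0] h}

/-! ### Tangencies of level sets with circles about the origin -/

/-- Near `q`, the level set of `f` through `q` lies outside the circle about the origin
through `q` (apart from `q` itself). -/
def LevelOutside (f : MvPolynomial (Fin 2) ℝ) (q : Plane) : Prop :=
  ∀ᶠ q' in 𝓝[≠] q, polyVal f q' = polyVal f q → ‖q‖ < ‖q'‖

/-- Near `q`, the level set of `f` through `q` lies inside the circle about the origin
through `q` (apart from `q` itself). -/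
def LevelInside (f : MvPolynomial (Fin 2) ℝ) (q : Plane) : Prop :=
  ∀ᶠ q' in 𝓝[≠] q, polyVal f q' = polyVal f q → ‖q'‖ < ‖q‖

open Classical in
/-- The number assigned to a point `q` where a smooth level curve of `f` is tangent to a circle
about the origin: `-1/2` if the level curve is locally outside the circle, `1/2` if it is locally
inside, and `0` otherwise (it crosses the circle, or is locally contained in it). -/
def tangencyNumber (f : MvPolynomial (Fin 2) ℝ) (q : Plane) : ℚ :=
  if LevelOutside f q then -1 / 2 else if LevelInside f q then 1 / 2 else 0

/-- The polynomial `x f_y - y f_x`. -/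
def tangencyPoly (f : MvPolynomial (Fin 2) ℝ) : MvPolynomial (Fin 2) ℝ :=
  X 0 * pderiv 1 f - X 1 * pderiv 0 f

/-- The curve of tangencies `x f_y - y f_x = 0`. -/
def tangencyCurve (f : MvPolynomial (Fin 2) ℝ) : Set Plane :=
  {q | polyVal (tangencyPoly f) q = 0}

/-! ### Ends of the curve of tangencies -/

/-- The part of the curve of tangencies in the exterior of the circle of radius `R`. -/
def exteriorCurve (f : MvPolynomial (Fin 2) ℝ) (R : ℝ) : Set Plane :=
  tangencyCurve f ∩ {q | R < ‖q‖}

/-- The connected components of the curve of tangencies in the exterior of the circle of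
radius `R`. -/
def ends (f : MvPolynomial (Fin 2) ℝ) (R : ℝ) : Set (Set Plane) :=
  {γ | ∃ q ∈ exteriorCurve f R, γ = connectedComponentIn (exteriorCurve f R) q}

/-- The filter "`q` goes to infinity along `γ`". -/
def alongEnd (γ : Set Plane) : Filter Plane :=
  cobounded Plane ⊓ 𝓟 γ

/-- `p(γ) = p`: the points of `γ` tend to `p` in the projective plane as they go to infinity. -/
def EndsAt (γ : Set Plane) (p : RP2) : Prop :=
  Tendsto toRP2 (alongEnd γ) (𝓝 p)

/-- `c(γ) = c`: the point `c` of `ℝ ∪ {∞}` is the limiting value of `f` along `γ`. -/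
def HasLimitValue (f : MvPolynomial (Fin 2) ℝ) (γ : Set Plane) (c : OnePoint ℝ) : Prop :=
  Tendsto (fun q => (polyVal f q : OnePoint ℝ)) (alongEnd γ) (𝓝 c)

/-- `m` is the number assigned to every point of `γ`. -/
def HasEndNumber (f : MvPolynomial (Fin 2) ℝ) (γ : Set Plane) (m : ℚ) : Prop :=
  ∀ q ∈ γ, tangencyNumber f q = m

open Classical in
/-- `i(γ)`: the number assigned to all the points of `γ` (and `0` if there is no such number). -/
def endNumber (f : MvPolynomial (Fin 2) ℝ) (γ : Set Plane) : ℚ :=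
  if h : ∃ m, HasEndNumber f γ m then h.choose else 0

/-- `i_{p,c}`, computed with the circle of radius `R`: the sum of `i(γ)` over the ends `γ` with
`p(γ) = p` and `c(γ) = c`. -/
def indexAt (f : MvPolynomial (Fin 2) ℝ) (R : ℝ) (p : RP2) (c : OnePoint ℝ) : ℚ :=
  ∑ᶠ γ ∈ {γ | γ ∈ ends f R ∧ EndsAt γ p ∧ HasLimitValue f γ c}, endNumber f γ

/-- The circle of radius `R` is so large that the ends of the curve of tangencies and their
invariants are well defined; an end is an arc that meets each larger circle exactly once.
If `x f_y - y f_x` is the zero polynomial (`f` is then a function of `x² + y²`), then the curve of tangencies is the whole plane, its exterior part is not an arc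
and has no endpoint on the line at infinity, and it contributes to none of the `i_{p,c}`. -/
structure IsLargeRadius (f : MvPolynomial (Fin 2) ℝ) (R : ℝ) : Prop where
  pos : 0 < R
  crit : ∀ q ∈ critSet f, ‖q‖ < R
  finite_ends : (ends f R).Finite
  unbounded : ∀ γ ∈ ends f R, ¬ IsBounded γ
  arc : tangencyPoly f ≠ 0 → ∀ γ ∈ ends f R, ∀ r > R, ∃! q, q ∈ γ ∧ ‖q‖ = r
  number : ∀ γ ∈ ends f R, ∃ m, HasEndNumber f γ m
  limitValue : ∀ γ ∈ ends f R, ∃ c, HasLimitValue f γ c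
  endpoint : tangencyPoly f ≠ 0 → ∀ γ ∈ ends f R, ∃ p ∈ lineAtInfinity, EndsAt γ p

end

open Filter Topology Bornology MvPolynomial

noncomputable section

/-! ### Common zeros of coprime polynomials -/

/-! Write `T = x f_y - y f_x` and `E = x f_x + y f_y`. In polar coordinates `T` is the angular
derivative of `f` and `E` is `ρ` times its radial derivative. On a circle around the critical points
let `φ` be the angle from the outward normal to `grad f`: then `T` and `E` are positive multiples of
`sin φ` and `cos φ`, and `φ` grows by `2π(i - 1)` in one turn. Thus `⌊φ/π⌋` grows by `2(i - 1)`. It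
jumps only at the zeros of `T`, by `sign E * (sR - sL) / 2`, where `sL`, `sR` are the signs of `T`
before and after the zero. This jump is twice the number of the tangency: where `E > 0`, the level
curve lies outside the circle if `f` restricted to the circle has a strict local maximum, inside if
it has a strict local minimum, and on neither side if `f` is strictly monotone there. So `i - 1` is
the sum of the tangency numbers on the circle (`HasGradIndex.eq_sum`).

It remains to organize the tangencies on all large circles into ends. If `T ≠ 0`, factor it into
irreducibles. A polynomial not divisible by an irreducible `h` has only finitely many common zeros
with `h` (`finite_commonZeros`). Hence far out the components of the curve are disjoint, transverse
to the circles and free of zeros of `E`; the last point uses isolatedness of the critical points.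
Over `(R, ∞)` the norm is then a finite covering of each component, so the curve splits into
finitely many arcs parametrized by the radius (`IsTransverse.exists_isArc`). Along an arc, a
quotient of polynomials takes all values except at most one only at bounded radii, so it cannot
oscillate (`IsArc.exists_tendsto_div`); this gives `c(γ)` and `p(γ)`. The number is constant because
it depends only on signs of polynomials that do not vanish on the arc. Each arc meets each large
circle once, and grouping the arcs by endpoint and limit value gives the formula
(`exists_arcSystem`, `ArcSystem.index_eq`).

If `T = 0`, then `φ` is constant, so `i = 1`, and the single end has no endpoint at infinity. -/

lemma MvPolynomial.finite_quotient_of_not_dvd {h A : MvPolynomial (Fin 2) ℝ}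
    (hh : Irreducible h) (hA : ¬ h ∣ A) :
    Module.Finite ℝ ((MvPolynomial (Fin 2) ℝ ⧸ Ideal.span {h}) ⧸
      Ideal.span {Ideal.Quotient.mk (Ideal.span {h}) A}) := by
  have hp : (Ideal.span {h}).IsPrime :=
    (Ideal.span_singleton_prime hh.ne_zero).2 hh.prime
  -- Both `h` and the class of `A` are nonzerodivisors, the latter because `ℝ[x, y]/(h)` is a
  -- domain. Each quotient lowers the Krull dimension by at least one, from 2 to at most 0, and a
  -- finitely generated algebra of dimension at most 0 over a field is finite-dimensional.
  have h1 := ringKrullDim_quotient_succ_le_of_nonZeroDivisor (mem_nonZeroDivisors_of_ne_zero hh.ne_zero)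
  have h2 := ringKrullDim_quotient_succ_le_of_nonZeroDivisor
    (r := Ideal.Quotient.mk (Ideal.span {h}) A) (mem_nonZeroDivisors_of_ne_zero (by
      rwa [Ne, Ideal.Quotient.eq_zero_iff_mem, Ideal.mem_span_singleton]))
  rw [MvPolynomial.ringKrullDim_of_isNoetherianRing, ringKrullDim_eq_zero_of_field] at h1
  refine (Module.finite_iff_krullDimLE_zero ℝ ((MvPolynomial (Fin 2) ℝ ⧸ Ideal.span {h}) ⧸
      Ideal.span {Ideal.Quotient.mk (Ideal.span {h}) A})).2 ?_
  rw [Ring.krullDimLE_iff]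
  simp at h1
  have h3 : ringKrullDim ((MvPolynomial (Fin 2) ℝ ⧸ Ideal.span {h}) ⧸
      Ideal.span {Ideal.Quotient.mk (Ideal.span {h}) A}) + 1 + 1 ≤ 2 :=
    le_trans (by gcongr) h1
  generalize ringKrullDim ((MvPolynomial (Fin 2) ℝ ⧸ Ideal.span {h}) ⧸
      Ideal.span {Ideal.Quotient.mk (Ideal.span {h}) A}) = d at h3
  induction d with
  | bot => simp
  | coe d =>
    induction d with
    | top => exact absurd h3 (by decide)
    | coe d => 
      have h4 : (((d + 1 + 1 : ℕ) : ℕ∞) : WithBot ℕ∞) ≤ ((2 : ℕ) : ℕ∞) := h3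
      have : d + 1 + 1 ≤ 2 := Nat.cast_le.1 (WithBot.coe_le_coe.1 h4)
      have : d ≤ 0 := by omega
      exact_mod_cast this

/-- In the finite-dimensional quotient each coordinate is integral over `ℝ`, so the ideal `(h, A)`
contains a monic polynomial in each single coordinate. Both coordinates of a common zero are
confined to finite sets of roots. -/
lemma finite_commonZeros {h A : MvPolynomial (Fin 2) ℝ} (hh : Irreducible h) (hA : ¬ h ∣ A) :
    {q : Plane | polyVal h q = 0 ∧ polyVal A q = 0}.Finite := by
  have hfin := MvPolynomial.finite_quotient_of_not_dvd hh hA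
  set B := (MvPolynomial (Fin 2) ℝ ⧸ Ideal.span {h}) ⧸
      Ideal.span {Ideal.Quotient.mk (Ideal.span {h}) A}
  let π : MvPolynomial (Fin 2) ℝ →ₐ[ℝ] B :=
    (Ideal.Quotient.mkₐ ℝ _).comp (Ideal.Quotient.mkₐ ℝ _)
  have hπ : ∀ p, π p = 0 → ∃ a b, p = a * h + b * A := by
    intro p hp
    have h1 : Ideal.Quotient.mk (Ideal.span {h}) p ∈
      Ideal.span {Ideal.Quotient.mk (Ideal.span {h}) A} := Ideal.Quotient.eq_zero_iff_mem.1 hp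
    obtain ⟨b, hb⟩ := Ideal.mem_span_singleton'.1 h1
    obtain ⟨b, rfl⟩ := Ideal.Quotient.mk_surjective b
    rw [← map_mul, eq_comm, Ideal.Quotient.mk_eq_mk_iff_sub_mem] at hb
    obtain ⟨a, ha⟩ := Ideal.mem_span_singleton'.1 hb
    exact ⟨a, b, by rw [ha]; ring⟩
  have key : ∀ k : Fin 2, ∃ d : Polynomial ℝ, d ≠ 0 ∧
      ∀ q : Plane, polyVal h q = 0 → polyVal A q = 0 → d.IsRoot (q k) := by
    intro k
    obtain ⟨d, hd, hd0⟩ := Algebra.IsIntegral.of_finite ℝ B |>.isIntegral (π (X k))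
    refine ⟨d, hd.ne_zero, fun q hq hq' => ?_⟩
    rw [← Polynomial.aeval_def, Polynomial.aeval_algHom_apply] at hd0
    obtain ⟨a, b, hab⟩ := hπ _ hd0
    have h3 := congrArg (MvPolynomial.aeval (fun k => q k)) hab
    rw [← Polynomial.aeval_algHom_apply, aeval_X, map_add, map_mul, map_mul] at h3
    simp only [MvPolynomial.aeval_eq_eval] at h3
    change _ = _ * polyVal h q + _ * polyVal A q at h3
    rw [hq, hq'] at h3
    simpa [Polynomial.IsRoot, Polynomial.aeval_def, Polynomial.eval₂_eq_eval_map] using h3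
  obtain ⟨d, hd, hd'⟩ := key 0
  obtain ⟨e, he, he'⟩ := key 1
  refine Set.Finite.subset (Set.Finite.image (fun x : ℝ × ℝ => (!₂[x.1, x.2] : Plane))
    ((Polynomial.finite_setOfPred_isRoot hd).prod (Polynomial.finite_setOfPred_isRoot he))) ?_
  rintro q ⟨h1, h2⟩
  exact ⟨(q 0, q 1), ⟨hd' q h1 h2, he' q h1 h2⟩, by ext i; fin_cases i <;> rfl⟩

lemma eventually_ne_zero_of_finite {p r : Plane → Prop}
    (hfin : {q : Plane | p q ∧ ¬ r q}.Finite) :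
    ∀ᶠ R in atTop, ∀ q : Plane, R < ‖q‖ → p q → r q := by
  obtain ⟨C, hC⟩ := hfin.isBounded.exists_norm_le
  filter_upwards [eventually_ge_atTop C] with R hR q hq hp
  by_contra h
  exact absurd (hC q ⟨hp, h⟩) (by linarith)

lemma eventually_ne_zero_of_not_dvd {h A : MvPolynomial (Fin 2) ℝ} (hh : Irreducible h)
    (hA : ¬ h ∣ A) :
    ∀ᶠ R in atTop, ∀ q : Plane, R < ‖q‖ → polyVal h q = 0 → polyVal A q ≠ 0 :=
  eventually_ne_zero_of_finite (by simpa using finite_commonZeros hh hA)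

/-! ### Evaluation and its derivatives -/

section polyVal
variable (f g : MvPolynomial (Fin 2) ℝ) (q : Plane)

@[simp] lemma polyVal_add : polyVal (f + g) q = polyVal f q + polyVal g q := by simp [polyVal]
@[simp] lemma polyVal_sub : polyVal (f - g) q = polyVal f q - polyVal g q := by simp [polyVal]
@[simp] lemma polyVal_neg : polyVal (-f) q = -polyVal f q := by simp [polyVal]
@[simp] lemma polyVal_mul : polyVal (f * g) q = polyVal f q * polyVal g q := by simp [polyVal]
@[simp] lemma polyVal_pow (n : ℕ) : polyVal (f ^ n) q = polyVal f q ^ n := by simp [polyVal]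
@[simp] lemma polyVal_C (c : ℝ) : polyVal (C c) q = c := by simp [polyVal]
@[simp] lemma polyVal_X (k : Fin 2) : polyVal (X k) q = q k := by simp [polyVal]
@[simp] lemma polyVal_zero : polyVal 0 q = 0 := by simp [polyVal]
@[simp] lemma polyVal_one : polyVal 1 q = 1 := by simp [polyVal]

end polyVal

lemma hasStrictFDerivAt_polyVal (f : MvPolynomial (Fin 2) ℝ) (q : Plane) :
    HasStrictFDerivAt (polyVal f)
      (polyVal (pderiv 0 f) q • (EuclideanSpace.proj 0 : Plane →L[ℝ] ℝ) +
        polyVal (pderiv 1 f) q • (EuclideanSpace.proj 1 : Plane →L[ℝ] ℝ)) q := by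
  induction f using MvPolynomial.induction_on with
  | C a =>
    have : polyVal (C a) = fun _ => a := by ext; simp
    rw [this]
    simpa using hasStrictFDerivAt_const a q
  | add f g hf hg =>
    have : polyVal (f + g) = fun q => polyVal f q + polyVal g q := by ext; simp
    rw [this]
    convert! hf.add hg using 1
    ext v; simp; ring
  | mul_X f k hf =>
    have : polyVal (f * X k) = fun q => polyVal f q * q k := by ext; simp
    rw [this]
    convert! hf.mul (EuclideanSpace.proj k : Plane →L[ℝ] ℝ).hasStrictFDerivAt using 1
    ext v
    fin_cases k <;> simp [pderiv_X] <;> ring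

lemma continuous_polyVal (f : MvPolynomial (Fin 2) ℝ) : Continuous (polyVal f) :=
  continuous_iff_continuousAt.2 fun q => (hasStrictFDerivAt_polyVal f q).continuousAt

lemma hasDerivAt_polyVal (f : MvPolynomial (Fin 2) ℝ) {a b : ℝ → ℝ} {a' b' t : ℝ}
    (ha : HasDerivAt a a' t) (hb : HasDerivAt b b' t) :
    HasDerivAt (fun t => polyVal f !₂[a t, b t])
      (polyVal (pderiv 0 f) !₂[a t, b t] * a' + polyVal (pderiv 1 f) !₂[a t, b t] * b') t := by
  have hc : HasDerivAt (fun t => (!₂[a t, b t] : Plane)) !₂[a', b'] t := by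
    have h2 : HasDerivAt (fun t => ![a t, b t]) ![a', b'] t := by
      refine hasDerivAt_pi.2 fun i => ?_
      fin_cases i
      · exact ha
      · exact hb
    exact (PiLp.hasFDerivAt_toLp (𝕜 := ℝ) 2 ![a t, b t]).comp_hasDerivAt t h2
  have := (hasStrictFDerivAt_polyVal f !₂[a t, b t]).hasFDerivAt.comp_hasDerivAt t hc
  convert! this using 1

/-- The polynomial `x f_x + y f_y`. -/
def radialPoly (f : MvPolynomial (Fin 2) ℝ) : MvPolynomial (Fin 2) ℝ :=
  X 0 * pderiv 0 f + X 1 * pderiv 1 f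

lemma polyVal_tangencyPoly (f : MvPolynomial (Fin 2) ℝ) (q : Plane) :
    polyVal (tangencyPoly f) q =
      q 0 * polyVal (pderiv 1 f) q - q 1 * polyVal (pderiv 0 f) q := by
  simp [tangencyPoly]

lemma polyVal_radialPoly (f : MvPolynomial (Fin 2) ℝ) (q : Plane) :
    polyVal (radialPoly f) q =
      q 0 * polyVal (pderiv 0 f) q + q 1 * polyVal (pderiv 1 f) q := by
  simp [radialPoly]

lemma norm_sq_plane (q : Plane) : ‖q‖ ^ 2 = q 0 ^ 2 + q 1 ^ 2 := by
  simp [EuclideanSpace.norm_sq_eq, Fin.sum_univ_two]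

lemma mem_critSet {f : MvPolynomial (Fin 2) ℝ} {q : Plane} :
    q ∈ critSet f ↔ polyVal (pderiv 0 f) q = 0 ∧ polyVal (pderiv 1 f) q = 0 := by
  constructor
  · intro h
    exact ⟨by simpa [gradAt] using congrArg (fun v : Plane => v 0) h,
      by simpa [gradAt] using congrArg (fun v : Plane => v 1) h⟩
  · rintro ⟨h0, h1⟩
    change gradAt f q = 0
    ext i; fin_cases i <;> simp [gradAt, h0, h1]

/-- Away from the origin `(x, y)` and `(-y, x)` form a basis, so a gradient orthogonal to both
vanishes. -/
lemma mem_critSet_iff {f : MvPolynomial (Fin 2) ℝ} {q : Plane} (hq : q ≠ 0) :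
    q ∈ critSet f ↔ polyVal (tangencyPoly f) q = 0 ∧ polyVal (radialPoly f) q = 0 := by
  rw [mem_critSet, polyVal_tangencyPoly, polyVal_radialPoly]
  have hn : q 0 ^ 2 + q 1 ^ 2 ≠ 0 := by
    rw [← norm_sq_plane]; simpa using hq
  constructor
  · rintro ⟨h0, h1⟩; simp [h0, h1]
  · rintro ⟨h0, h1⟩
    constructor
    · refine (mul_eq_zero.1 (?_ : (q 0 ^ 2 + q 1 ^ 2) * _ = 0)).resolve_left hn
      linear_combination q 0 * h1 - q 1 * h0
    · refine (mul_eq_zero.1 (?_ : (q 0 ^ 2 + q 1 ^ 2) * _ = 0)).resolve_left hn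
      linear_combination q 1 * h1 + q 0 * h0

/-- The rotation field and the Euler field commute. Consequently `radialPoly f` is rotation
invariant whenever `f` is. -/
lemma tangencyPoly_radialPoly (f : MvPolynomial (Fin 2) ℝ) :
    tangencyPoly (radialPoly f) = radialPoly (tangencyPoly f) := by
  have hc : pderiv (R := ℝ) (0 : Fin 2) (pderiv 1 f) = pderiv 1 (pderiv 0 f) := by
    induction f using MvPolynomial.induction_on with
    | C a => simp
    | add f g hf hg => simp [hf, hg]
    | mul_X f k hf =>
      fin_cases k <;> simp [Derivation.leibniz, pderiv_X, hf, add_comm]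
  simp [tangencyPoly, radialPoly, Derivation.leibniz, pderiv_X, hc]
  ring

/-! ### Polar coordinates -/

@[simp] lemma circlePoint_zero_coord (ρ t : ℝ) : circlePoint ρ t 0 = ρ * Real.cos t := rfl
@[simp] lemma circlePoint_one_coord (ρ t : ℝ) : circlePoint ρ t 1 = ρ * Real.sin t := rfl

lemma norm_circlePoint (ρ t : ℝ) : ‖circlePoint ρ t‖ = |ρ| := by
  rw [← sq_eq_sq₀ (norm_nonneg _) (abs_nonneg _), norm_sq_plane, sq_abs]
  simp only [circlePoint_zero_coord, circlePoint_one_coord]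
  linear_combination ρ ^ 2 * Real.sin_sq_add_cos_sq t

lemma continuous_circlePoint : Continuous fun x : ℝ × ℝ => circlePoint x.1 x.2 := by
  unfold circlePoint
  refine (PiLp.continuous_toLp 2 _).comp (continuous_pi fun i => ?_)
  fin_cases i <;> simp <;> fun_prop

lemma exists_circlePoint (q : Plane) : ∃ t : ℝ, circlePoint ‖q‖ t = q := by
  refine ⟨Complex.arg ⟨q 0, q 1⟩, ?_⟩
  have hn : ‖(⟨q 0, q 1⟩ : ℂ)‖ = ‖q‖ := by
    rw [← sq_eq_sq₀ (norm_nonneg _) (norm_nonneg _), norm_sq_plane, Complex.sq_norm,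
      Complex.normSq_apply]
    ring
  ext i; fin_cases i
  · simpa [hn] using Complex.norm_mul_cos_arg ⟨q 0, q 1⟩
  · simpa [hn] using Complex.norm_mul_sin_arg ⟨q 0, q 1⟩

lemma hasDerivAt_polyVal_circlePoint (f : MvPolynomial (Fin 2) ℝ) (ρ t : ℝ) :
    HasDerivAt (fun t => polyVal f (circlePoint ρ t))
      (polyVal (tangencyPoly f) (circlePoint ρ t)) t := by
  have := hasDerivAt_polyVal f ((Real.hasDerivAt_cos t).const_mul ρ)
    ((Real.hasDerivAt_sin t).const_mul ρ)
  convert! this using 1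
  rw [polyVal_tangencyPoly]
  change ρ * Real.cos t * polyVal (pderiv 1 f) !₂[ρ * Real.cos t, ρ * Real.sin t] -
    ρ * Real.sin t * polyVal (pderiv 0 f) !₂[ρ * Real.cos t, ρ * Real.sin t] = _
  ring

lemma hasDerivAt_polyVal_radius (f : MvPolynomial (Fin 2) ℝ) {ρ : ℝ} (hρ : ρ ≠ 0) (t : ℝ) :
    HasDerivAt (fun ρ => polyVal f (circlePoint ρ t))
      (polyVal (radialPoly f) (circlePoint ρ t) / ρ) ρ := by
  have := hasDerivAt_polyVal f ((hasDerivAt_id ρ).mul_const (Real.cos t))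
    ((hasDerivAt_id ρ).mul_const (Real.sin t))
  convert! this using 1
  rw [polyVal_radialPoly]
  change (ρ * Real.cos t * polyVal (pderiv 0 f) !₂[ρ * Real.cos t, ρ * Real.sin t] +
    ρ * Real.sin t * polyVal (pderiv 1 f) !₂[ρ * Real.cos t, ρ * Real.sin t]) / ρ = _
  simp only [id]
  field_simp

/-! ### Curves transverse to the circles about the origin -/

/-- Outside the circle of radius `R`, the zero set of `h` is transverse to the circles about the
origin. -/
def IsTransverse (h : MvPolynomial (Fin 2) ℝ) (R : ℝ) : Prop :=
  ∀ q : Plane, R < ‖q‖ → polyVal h q = 0 → polyVal (tangencyPoly h) q ≠ 0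

/-- A continuous parametrization by the radius of an arc of the zero set of `h`. -/
structure IsArc (h : MvPolynomial (Fin 2) ℝ) (R : ℝ) (σ : ℝ → Plane) : Prop where
  continuousOn : ContinuousOn σ (Set.Ioi R)
  norm_eq : ∀ r > R, ‖σ r‖ = r
  polyVal_eq : ∀ r > R, polyVal h (σ r) = 0

/-- Where the zero set of `h` is transverse to the circles, `q ↦ (|q|², h(q))` is a local
homeomorphism of the plane. -/
lemma exists_openPartialHomeomorph {h : MvPolynomial (Fin 2) ℝ} {q : Plane}
    (hq : polyVal (tangencyPoly h) q ≠ 0) :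
    ∃ e : OpenPartialHomeomorph Plane (ℝ × ℝ), q ∈ e.source ∧
      ∀ q', e q' = (‖q'‖ ^ 2, polyVal h q') := by
  obtain ⟨L, hd, hLv⟩ : ∃ L : Plane →L[ℝ] ℝ × ℝ,
      HasStrictFDerivAt (fun q => (polyVal (X 0 * X 0 + X 1 * X 1) q, polyVal h q)) L q ∧
      ∀ v : Plane, L v = (2 * (q 0 * v 0 + q 1 * v 1),
        polyVal (pderiv 0 h) q * v 0 + polyVal (pderiv 1 h) q * v 1) := by
    refine ⟨_, (hasStrictFDerivAt_polyVal (X 0 * X 0 + X 1 * X 1) q).prodMk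
      (hasStrictFDerivAt_polyVal h q), fun v => ?_⟩
    simp [pderiv_X]
    ring
  -- The determinant of `L` is twice the value of `tangencyPoly h` at `q`; the combinations below
  -- are Cramer's rule.
  have hinj : Function.Injective L := by
    rw [injective_iff_map_eq_zero]
    intro v hv
    rw [hLv, Prod.mk_eq_zero] at hv
    obtain ⟨h1, h2⟩ := hv
    rw [polyVal_tangencyPoly] at hq
    ext i; fin_cases i
    · refine (mul_eq_zero.1 (?_ : _ * v 0 = 0)).resolve_left hq
      linear_combination polyVal (pderiv 1 h) q / 2 * h1 - q 1 * h2
    · refine (mul_eq_zero.1 (?_ : _ * v 1 = 0)).resolve_left hq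
      linear_combination - polyVal (pderiv 0 h) q / 2 * h1 + q 0 * h2
  let L' : Plane ≃L[ℝ] ℝ × ℝ := (LinearEquiv.ofInjectiveOfFinrankEq L.toLinearMap hinj
    (by simp)).toContinuousLinearEquiv
  have hL' : (L' : Plane →L[ℝ] ℝ × ℝ) = L := by ext v <;> rfl
  rw [← hL'] at hd
  refine ⟨hd.toOpenPartialHomeomorph _, hd.mem_toOpenPartialHomeomorph_source, fun q' => ?_⟩
  rw [hd.toOpenPartialHomeomorph_coe]
  rw [norm_sq_plane]
  simp [pow_two]

lemma exists_injOn_nhds {h : MvPolynomial (Fin 2) ℝ} {q : Plane}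
    (hq : polyVal (tangencyPoly h) q ≠ 0) :
    ∃ U : Set Plane, IsOpen U ∧ q ∈ U ∧ ∀ x ∈ U, ∀ y ∈ U, polyVal h x = 0 → polyVal h y = 0 →
      ‖x‖ = ‖y‖ → x = y := by
  obtain ⟨e, heq, he⟩ := exists_openPartialHomeomorph hq
  refine ⟨e.source, e.open_source, heq, fun x hx y hy h1 h2 h3 => e.injOn hx hy ?_⟩
  rw [he, he, h1, h2, h3]

/-- Openness of the norm on the zero set: `r ↦ e.symm (r ^ 2, 0)` is a local section, giving zeros
of `h` of every norm near `‖q‖`. Positivity of `‖q‖` is what allows `r` to be recovered from `r ^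
2`. -/
lemma nhds_norm_le_map {h : MvPolynomial (Fin 2) ℝ} (q : {q : Plane // polyVal h q = 0})
    (hq0 : 0 < ‖q.1‖) (hq : polyVal (tangencyPoly h) q ≠ 0) :
    𝓝 ‖q.1‖ ≤ map (fun q : {q : Plane // polyVal h q = 0} => ‖q.1‖) (𝓝 q) := by
  obtain ⟨e, heq, he⟩ := exists_openPartialHomeomorph hq
  have hek : e q.1 = (‖q.1‖ ^ 2, 0) := by rw [he, q.2]
  have hcont : ContinuousAt (fun r : ℝ => e.symm (r ^ 2, 0)) ‖q.1‖ := by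
    refine ContinuousAt.comp (f := fun r : ℝ => ((r ^ 2, 0) : ℝ × ℝ)) ?_ (by fun_prop)
    rw [← hek]
    exact e.continuousAt_symm (e.map_source heq)
  have hval : e.symm (‖q.1‖ ^ 2, 0) = q.1 := by rw [← hek, e.left_inv heq]
  have htgt : ∀ᶠ r : ℝ in 𝓝 ‖q.1‖, ((r ^ 2, 0) : ℝ × ℝ) ∈ e.target := by
    have : ContinuousAt (fun r : ℝ => ((r ^ 2, 0) : ℝ × ℝ)) ‖q.1‖ := by fun_prop
    refine this.eventually (e.open_target.mem_nhds ?_)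
    change ((‖q.1‖ ^ 2, 0) : ℝ × ℝ) ∈ _
    rw [← hek]; exact e.map_source heq
  intro s hs
  rw [mem_map, nhds_subtype_eq_comap, mem_comap] at hs
  obtain ⟨t, ht, hts⟩ := hs
  have h1 : ∀ᶠ r in 𝓝 ‖q.1‖, e.symm (r ^ 2, 0) ∈ t := by
    refine hcont.eventually (?_ : t ∈ 𝓝 (e.symm (‖q.1‖ ^ 2, 0)))
    rwa [hval]
  filter_upwards [h1, htgt, lt_mem_nhds hq0] with r h1 h2 h3
  have h4 := e.right_inv h2
  rw [he, Prod.mk.injEq] at h4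
  have h5 : ‖e.symm (r ^ 2, 0)‖ = r := by
    rw [sq_eq_sq₀ (norm_nonneg _) h3.le] at h4
    exact h4.1
  have := @hts ⟨e.symm (r ^ 2, 0), h4.2⟩ h1
  simpa [h5] using this

lemma IsTransverse.isLocalHomeomorphOn {h : MvPolynomial (Fin 2) ℝ} {R : ℝ} (hR : 0 ≤ R)
    (hh : IsTransverse h R) :
    IsLocalHomeomorphOn (fun q : {q : Plane // polyVal h q = 0} => ‖q.1‖)
      ((fun q : {q : Plane // polyVal h q = 0} => ‖q.1‖) ⁻¹' Set.Ioi R) := by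
  rw [isLocalHomeomorphOn_iff_isOpenEmbedding_restrict]
  intro q hq
  have hq' : R < ‖q.1‖ := hq
  obtain ⟨U, hUo, hqU, hU⟩ := exists_injOn_nhds (hh q hq' q.2)
  have hV : IsOpen {x : {q : Plane // polyVal h q = 0} | R < ‖x.1‖ ∧ x.1 ∈ U} :=
    (isOpen_lt continuous_const continuous_subtype_val.norm).inter (hUo.preimage continuous_subtype_val)
  refine ⟨_, hV.mem_nhds ⟨hq', hqU⟩, .of_continuous_injective_isOpenMap ?_ ?_ ?_⟩
  · fun_prop
  · rintro ⟨x, hx⟩ ⟨y, hy⟩ hxy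
    exact Subtype.ext (Subtype.ext (hU _ hx.2 _ hy.2 x.2 y.2 hxy))
  · rw [isOpenMap_iff_nhds_le]
    rintro ⟨x, hx⟩
    have h1 := nhds_norm_le_map x (hR.trans_lt hx.1) (hh x hx.1 x.2)
    rw [← map_nhds_subtype_coe_eq_nhds hx (hV.mem_nhds hx), Filter.map_map] at h1
    exact h1

/-- The set is compact, and discrete by local injectivity of the norm on the zero set. -/
lemma finite_setOf_polyVal_norm {h : MvPolynomial (Fin 2) ℝ} {R r : ℝ}
    (hh : IsTransverse h R) (hr : R < r) : {q : Plane | polyVal h q = 0 ∧ ‖q‖ = r}.Finite := by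
  have hc : IsCompact {q : Plane | polyVal h q = 0 ∧ ‖q‖ = r} := by
    refine (isCompact_sphere (0 : Plane) r).of_isClosed_subset ?_ fun q hq => by simpa using hq.2
    exact (isClosed_eq (continuous_polyVal h) continuous_const).inter
      (isClosed_eq continuous_norm continuous_const)
  refine hc.finite (isDiscrete_iff_forall_mem_exists_isOpen.2 fun q hq => ?_)
  obtain ⟨U, hUo, hqU, hU⟩ := exists_injOn_nhds (hh q (hq.2 ▸ hr) hq.1)
  refine ⟨U, hUo, ?_⟩
  ext x
  constructor
  · rintro ⟨h1, h2⟩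
    exact hU x h1 q hqU h2.1 hq.1 (h2.2.trans hq.2.symm)
  · rintro rfl
    exact ⟨hqU, hq⟩

/-- The norm is proper, hence closed, also on the closed zero set; a closed local homeomorphism with
finite fibres is a covering. -/
lemma IsTransverse.isCoveringMapOn {h : MvPolynomial (Fin 2) ℝ} {R : ℝ} (hR : 0 ≤ R)
    (hh : IsTransverse h R) :
    IsCoveringMapOn (fun q : {q : Plane // polyVal h q = 0} => ‖q.1‖) (Set.Ioi R) := by
  have hcl : IsClosed {q : Plane | polyVal h q = 0} :=
    isClosed_eq (continuous_polyVal h) continuous_const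
  refine IsClosedMap.isCoveringMapOn_of_isLocalHomeomorphOn ?_ (fun r hr => ?_)
    (hh.isLocalHomeomorphOn hR)
  · have h1 : IsClosedMap (fun q : Plane => ‖q‖) :=
      ((isProperMap_iff_tendsto_cocompact.2
        ⟨continuous_norm, tendsto_norm_cocompact_atTop.mono_right
          atTop_le_cocompact⟩)).isClosedMap
    exact h1.comp hcl.isClosedMap_subtype_val
  · refine Set.Finite.of_finite_image ((finite_setOf_polyVal_norm hh hr).subset ?_)
      Subtype.val_injective.injOn
    rintro _ ⟨x, hx, rfl⟩
    exact ⟨x.2, hx⟩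

/-- The interval `(R, ∞)` is simply connected, so its identity map lifts through the covering by the
norm, with prescribed value `q` at `‖q‖`. -/
lemma IsTransverse.exists_isArc {h : MvPolynomial (Fin 2) ℝ} {R : ℝ} (hR : 0 ≤ R)
    (hh : IsTransverse h R) {q : Plane} (hq : R < ‖q‖) (hq0 : polyVal h q = 0) :
    ∃ σ, IsArc h R σ ∧ σ ‖q‖ = q := by
  classical
  have : SimplyConnectedSpace (Set.Ioi R) := by
    have := (convex_Ioi R).contractibleSpace ⟨_, hq⟩
    infer_instance
  have : LocallyPathConnectedSpace (Set.Ioi R) := isOpen_Ioi.locallyPathConnectedSpace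
  obtain ⟨F, ⟨hF1, hF2⟩, -⟩ := (hh.isCoveringMapOn hR).existsUnique_continuousMap_lifts
    (A := Set.Ioi R) ⟨Subtype.val, continuous_subtype_val⟩ (a₀ := ⟨‖q‖, hq⟩) (e₀ := ⟨q, hq0⟩) rfl
    (fun a => a.2)
  have hF3 : ∀ r (hr : R < r), ‖(F ⟨r, hr⟩).1‖ = r := fun r hr => congrFun hF2 ⟨r, hr⟩
  refine ⟨fun r => if hr : R < r then (F ⟨r, hr⟩).1 else 0, ⟨?_, ?_, ?_⟩, ?_⟩
  · rw [continuousOn_iff_continuous_domRestrict]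
    convert! continuous_subtype_val.comp F.continuous using 1
    ext1 ⟨x, hx⟩
    have hx' : R < x := hx
    simp [hx']
  · intro r hr
    have hr' : R < r := hr
    simp [hr', hF3]
  · intro r hr
    have hr' : R < r := hr
    simp only [hr', dite_true]
    exact (F ⟨r, hr⟩).2
  · simp [hq, hF1]

/-- The set of radii where the two arcs agree is closed, and open because the norm is locally
injective on the zero set. -/
lemma IsArc.eqOn {h : MvPolynomial (Fin 2) ℝ} {R : ℝ} (hh : IsTransverse h R)
    {σ τ : ℝ → Plane} (hσ : IsArc h R σ) (hτ : IsArc h R τ) {r : ℝ} (hr : R < r)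
    (hστ : σ r = τ r) : Set.EqOn σ τ (Set.Ioi R) := by
  have hs : IsPreconnected (Set.Ioi R) := isPreconnected_Ioi
  intro s hs'
  have hc : IsClosed {x : Set.Ioi R | σ x = τ x} :=
    isClosed_eq (continuousOn_iff_continuous_domRestrict.1 hσ.continuousOn)
      (continuousOn_iff_continuous_domRestrict.1 hτ.continuousOn)
  have ho : IsOpen {x : Set.Ioi R | σ x = τ x} := by
    rw [isOpen_iff_mem_nhds]
    rintro ⟨x, hx⟩ (hxx : σ x = τ x)
    obtain ⟨U, hUo, hqU, hU⟩ := exists_injOn_nhds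
      (hh (σ x) (by rwa [hσ.norm_eq x hx]) (hσ.polyVal_eq x hx))
    have h1 : ∀ᶠ y : Set.Ioi R in 𝓝 ⟨x, hx⟩, σ y ∈ U :=
      (continuousOn_iff_continuous_domRestrict.1 hσ.continuousOn).continuousAt.eventually
        (hUo.mem_nhds hqU)
    have h2 : ∀ᶠ y : Set.Ioi R in 𝓝 ⟨x, hx⟩, τ y ∈ U :=
      (continuousOn_iff_continuous_domRestrict.1 hτ.continuousOn).continuousAt.eventually
        (hUo.mem_nhds (show τ x ∈ U from hxx ▸ hqU))
    filter_upwards [h1, h2] with y h1 h2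
    exact hU _ h1 _ h2 (hσ.polyVal_eq y y.2) (hτ.polyVal_eq y y.2)
      ((hσ.norm_eq y y.2).trans (hτ.norm_eq y y.2).symm)
  have := isPreconnected_iff_preconnectedSpace.1 hs
  have huniv := IsClopen.eq_univ ⟨hc, ho⟩ ⟨⟨r, hr⟩, hστ⟩
  exact huniv.ge (Set.mem_univ ⟨s, hs'⟩)

/-! ### Irreducible curves are transverse to large circles -/

/-- If `tangencyPoly h = h * u`, then on each circle `h` satisfies the linear equation `y' = u y` in
the angle, so by Grönwall one zero forces `h` to vanish on the whole circle. -/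
lemma polyVal_circlePoint_eq_zero {h : MvPolynomial (Fin 2) ℝ} (hd : h ∣ tangencyPoly h)
    {ρ t : ℝ} (h0 : polyVal h (circlePoint ρ t) = 0) (s : ℝ) :
    polyVal h (circlePoint ρ s) = 0 := by
  obtain ⟨u, hu⟩ := hd
  have hcont : ∀ p : MvPolynomial (Fin 2) ℝ, Continuous fun x => polyVal p (circlePoint ρ x) :=
    fun p => (continuous_polyVal p).comp (continuous_circlePoint.comp (Continuous.prodMk_right ρ))
  have key : ∀ x, t ≤ x → polyVal h (circlePoint ρ x) = 0 := by
    intro x hx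
    obtain ⟨K, hK⟩ := isCompact_Icc.exists_bound_of_continuousOn
      (s := Set.Icc t x) (hcont u).continuousOn
    refine eq_zero_of_abs_deriv_le_mul_abs_self_of_eq_zero_right (a := t) (b := x) (K := K)
      (f := fun x => polyVal h (circlePoint ρ x)) (hcont h).continuousOn
      (fun y _ => (hasDerivAt_polyVal_circlePoint h ρ y).hasDerivWithinAt) h0 ?_ x ⟨hx, le_rfl⟩
    intro y hy
    rw [hu, polyVal_mul, mul_comm, norm_mul]
    gcongr
    exact hK y ⟨hy.1, hy.2.le⟩
  -- The estimate only runs forward from `t`, so `s` is moved beyond `t` by full turns.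
  obtain ⟨n, hn⟩ := exists_nat_ge ((t - s) / (2 * Real.pi))
  have h1 := key (s + n * (2 * Real.pi)) (by
    rw [div_le_iff₀ (by positivity)] at hn; linarith)
  have h2 : circlePoint ρ (s + n * (2 * Real.pi)) = circlePoint ρ s := by
    simp [circlePoint, Real.cos_add_nat_mul_two_pi, Real.sin_add_nat_mul_two_pi]
  rwa [h2] at h1

/-- If `h` does not divide `tangencyPoly h`, the two have finitely many common zeros. Otherwise the
zero set is a union of circles about the origin, each meeting the positive `x`-axis. If `y` divides
`h`, all circles occur and `h = 0`, which is absurd; if not, `h` has finitely many zeros on the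
axis, so there are no zeros far out and transversality is vacuous. -/
lemma eventually_isTransverse {h : MvPolynomial (Fin 2) ℝ} (hh : Irreducible h) :
    ∀ᶠ R in atTop, IsTransverse h R := by
  by_cases hd : h ∣ tangencyPoly h
  · have hX : Irreducible (X 1 : MvPolynomial (Fin 2) ℝ) := MvPolynomial.X_prime.irreducible
    by_cases hx : (X 1 : MvPolynomial (Fin 2) ℝ) ∣ h
    · obtain ⟨c, hc⟩ := hx
      obtain ⟨u, hu⟩ := hd
      exfalso
      have h2 : ∀ ρ s : ℝ, polyVal h (circlePoint ρ s) = 0 := fun ρ =>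
        polyVal_circlePoint_eq_zero ⟨u, hu⟩ (t := 0) (by rw [hc]; simp)
      refine hh.ne_zero (MvPolynomial.funext fun v => ?_)
      obtain ⟨t, ht⟩ := exists_circlePoint (WithLp.toLp 2 v)
      have h3 := h2 ‖(WithLp.toLp 2 v : Plane)‖ t
      rw [ht] at h3
      simpa [polyVal] using h3
    · filter_upwards [eventually_ne_zero_of_not_dvd hX hx, eventually_ge_atTop 0] with R hR hR0 q hq hq0
      exfalso
      obtain ⟨t, ht⟩ := exists_circlePoint q
      have h1 := polyVal_circlePoint_eq_zero hd (ρ := ‖q‖) (t := t) (by rwa [ht]) 0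
      exact hR (circlePoint ‖q‖ 0) (by rw [norm_circlePoint]; simpa using hq) (by simp) h1
  · exact eventually_ne_zero_of_not_dvd hh hd

/-! ### The number of a tangency -/

lemma circlePoint_add_two_pi (ρ t : ℝ) : circlePoint ρ (t + 2 * Real.pi) = circlePoint ρ t := by
  simp [circlePoint]

lemma eq_of_circlePoint_eq {ρ s t : ℝ} (hρ : ρ ≠ 0) (h : circlePoint ρ s = circlePoint ρ t)
    (hst : |s - t| < 2 * Real.pi) : s = t := by
  have h0 := congrArg (fun v : Plane => v 0) h
  have h1 := congrArg (fun v : Plane => v 1) h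
  simp only [circlePoint_zero_coord, circlePoint_one_coord, mul_eq_mul_left_iff, hρ, or_false] at h0 h1
  have h2 : Real.cos (s - t) = 1 := by
    rw [Real.cos_sub, h0, h1]
    linear_combination Real.sin_sq_add_cos_sq t
  rw [abs_lt] at hst
  linarith [(Real.cos_eq_one_iff_of_lt_of_lt (by linarith) hst.2).1 h2]

/-- A local choice of the polar angle. -/
lemma exists_polar_angle {r₀ : ℝ} (hr : 0 < r₀) (t₀ : ℝ) :
    ∃ τ : Plane → ℝ, Tendsto τ (𝓝 (circlePoint r₀ t₀)) (𝓝 t₀) ∧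
      ∀ q, circlePoint ‖q‖ (τ q) = q := by
  -- `w q` is `q` rotated by `-t₀`, which brings the base point to the positive real axis, where
  -- `Complex.arg` is continuous.
  let w : Plane → ℂ := fun q =>
    ⟨q 0 * Real.cos t₀ + q 1 * Real.sin t₀, - q 0 * Real.sin t₀ + q 1 * Real.cos t₀⟩
  have hw : w = fun q => ((q 0 * Real.cos t₀ + q 1 * Real.sin t₀ : ℝ) : ℂ) +
      ((- q 0 * Real.sin t₀ + q 1 * Real.cos t₀ : ℝ) : ℂ) * Complex.I := by
    ext q; exact (Complex.re_add_im (w q)).symm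
  have hwc : Continuous w := by
    rw [hw]; fun_prop
  have hw0 : w (circlePoint r₀ t₀) = (r₀ : ℂ) := by
    apply Complex.ext
    · simp [w]
      linear_combination r₀ * Real.sin_sq_add_cos_sq t₀
    · simp [w]; ring
  have hn : ∀ q, ‖w q‖ = ‖q‖ := by
    intro q
    rw [← sq_eq_sq₀ (norm_nonneg _) (norm_nonneg _), norm_sq_plane, Complex.sq_norm,
      Complex.normSq_apply]
    linear_combination (q 0 ^ 2 + q 1 ^ 2) * Real.sin_sq_add_cos_sq t₀
  refine ⟨fun q => t₀ + Complex.arg (w q), ?_, fun q => ?_⟩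
  · have h1 : ContinuousAt (fun q => t₀ + Complex.arg (w q)) (circlePoint r₀ t₀) := by
      refine continuousAt_const.add (ContinuousAt.comp (f := w) (g := Complex.arg) ?_
        hwc.continuousAt)
      rw [hw0]
      exact Complex.continuousAt_arg (Complex.ofReal_mem_slitPlane.2 hr)
    have h2 := h1.tendsto
    simp only [hw0, Complex.arg_ofReal_of_nonneg hr.le, add_zero] at h2
    exact h2
  · have h0 : ‖q‖ * Real.cos (Complex.arg (w q)) = q 0 * Real.cos t₀ + q 1 * Real.sin t₀ := by
      rw [← hn q]; exact Complex.norm_mul_cos_arg (w q)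
    have h1 : ‖q‖ * Real.sin (Complex.arg (w q)) = - q 0 * Real.sin t₀ + q 1 * Real.cos t₀ := by
      rw [← hn q]; exact Complex.norm_mul_sin_arg (w q)
    ext i; fin_cases i
    · change ‖q‖ * Real.cos _ = q 0
      rw [Real.cos_add]
      linear_combination Real.cos t₀ * h0 - Real.sin t₀ * h1 + q 0 * Real.sin_sq_add_cos_sq t₀
    · change ‖q‖ * Real.sin _ = q 1
      rw [Real.sin_add]
      linear_combination Real.sin t₀ * h0 + Real.cos t₀ * h1 + q 1 * Real.sin_sq_add_cos_sq t₀

lemma eventually_nhds_of_polar {r₀ t₀ : ℝ} (hr : 0 < r₀) {P : ℝ × ℝ → Prop}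
    (h : ∀ᶠ x : ℝ × ℝ in 𝓝 (r₀, t₀), P x) :
    ∀ᶠ q in 𝓝 (circlePoint r₀ t₀), ∃ t, circlePoint ‖q‖ t = q ∧ P (‖q‖, t) := by
  obtain ⟨τ, hτ, hτ'⟩ := exists_polar_angle hr t₀
  have h1 : Tendsto (fun q => (‖q‖, τ q)) (𝓝 (circlePoint r₀ t₀)) (𝓝 (r₀, t₀)) := by
    refine Tendsto.prodMk_nhds ?_ hτ
    have := (continuous_norm (E := Plane)).tendsto (circlePoint r₀ t₀)
    rwa [norm_circlePoint, abs_of_pos hr] at this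
  filter_upwards [h1.eventually h] with q hq
  exact ⟨τ q, hτ' q, hq⟩

section Local
variable {f : MvPolynomial (Fin 2) ℝ} {r₀ t₀ : ℝ}

/-- Where `E > 0` the value of `f` grows along rays, uniformly for nearby angles. Comparing radii on
a level curve is thereby reduced to comparing values of `f` on the circle. -/
lemma exists_strictMonoOn_radius (hr : 0 < r₀)
    (hE : 0 < polyVal (radialPoly f) (circlePoint r₀ t₀)) :
    ∃ ε > 0, ε < r₀ ∧ ∀ t, |t - t₀| < ε →
      StrictMonoOn (fun ρ => polyVal f (circlePoint ρ t)) (Set.Ioo (r₀ - ε) (r₀ + ε)) := by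
  have hc : Continuous fun x : ℝ × ℝ => polyVal (radialPoly f) (circlePoint x.1 x.2) :=
    (continuous_polyVal _).comp continuous_circlePoint
  obtain ⟨ε, hε, hball⟩ := Metric.eventually_nhds_iff.1
    (hc.continuousAt.eventually (lt_mem_nhds hE) : ∀ᶠ x : ℝ × ℝ in 𝓝 (r₀, t₀), _)
  refine ⟨min ε (r₀ / 2), by positivity, (min_le_right _ _).trans_lt (by linarith), fun t ht => ?_⟩
  have hρ : ∀ ρ ∈ Set.Ioo (r₀ - min ε (r₀ / 2)) (r₀ + min ε (r₀ / 2)), 0 < ρ := fun ρ hρ => by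
    linarith [hρ.1, min_le_right ε (r₀ / 2)]
  refine strictMonoOn_of_deriv_pos (convex_Ioo _ _) (fun ρ h => ?_) (fun ρ h => ?_)
  · exact (hasDerivAt_polyVal_radius f (hρ ρ h).ne' t).continuousAt.continuousWithinAt
  · rw [interior_Ioo] at h
    rw [(hasDerivAt_polyVal_radius f (hρ ρ h).ne' t).deriv]
    refine div_pos (hball (y := (ρ, t)) ?_) (hρ ρ h)
    rw [Prod.dist_eq, Real.dist_eq, Real.dist_eq]
    refine max_lt (abs_lt.2 ⟨?_, ?_⟩) (ht.trans_le (min_le_left _ _))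
    · linarith [h.1, min_le_left ε (r₀ / 2)]
    · linarith [h.2, min_le_left ε (r₀ / 2)]

lemma eventually_box {r₀ t₀ ε : ℝ} (hε : 0 < ε) : ∀ᶠ x : ℝ × ℝ in 𝓝 (r₀, t₀),
    x.1 ∈ Set.Ioo (r₀ - ε) (r₀ + ε) ∧ |x.2 - t₀| < ε := by
  refine Filter.Eventually.and ?_ ?_
  · exact continuous_fst.continuousAt.eventually (Ioo_mem_nhds (by simpa) (by simpa))
  · refine continuous_snd.continuousAt.eventually (p := fun t => |t - t₀| < ε) ?_
    filter_upwards [Metric.ball_mem_nhds t₀ hε] with t ht using ht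

/-- On a ray where `f` is below the level at radius `r₀`, the level can only be reached at a larger
radius. On the ray of angle `t₀` itself, strict monotonicity leaves the base point alone. -/
lemma levelOutside_of_eventually_lt (hr : 0 < r₀)
    (hE : 0 < polyVal (radialPoly f) (circlePoint r₀ t₀))
    (h : ∀ᶠ t in 𝓝[≠] t₀, polyVal f (circlePoint r₀ t) < polyVal f (circlePoint r₀ t₀)) :
    LevelOutside f (circlePoint r₀ t₀) := by
  obtain ⟨ε, hε, -, hmono⟩ := exists_strictMonoOn_radius hr hE
  rw [eventually_nhdsWithin_iff] at h
  have h2 := eventually_nhds_of_polar hr ((eventually_box hε).and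
    ((continuous_snd.tendsto (r₀, t₀)).eventually h))
  rw [LevelOutside, eventually_nhdsWithin_iff]
  filter_upwards [h2] with q hq hqne hfq
  obtain ⟨t, hqt, ⟨hρ, ht⟩, htt⟩ := hq
  rw [norm_circlePoint, abs_of_pos hr]
  by_contra! hle
  have h3 : polyVal f (circlePoint ‖q‖ t) ≤ polyVal f (circlePoint r₀ t) :=
    (hmono t ht).monotoneOn hρ ⟨by linarith, by linarith⟩ hle
  rw [hqt, hfq] at h3
  by_cases hne : t = t₀
  · subst hne
    rcases hle.lt_or_eq with hlt | heq
    · have := hmono t ht hρ ⟨by linarith, by linarith⟩ hlt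
      simp only [hqt, hfq, lt_irrefl] at this
    · exact hqne (by rw [Set.mem_singleton_iff, ← heq, hqt])
  · exact absurd (htt hne) (not_lt.2 h3)

lemma levelInside_of_eventually_lt (hr : 0 < r₀)
    (hE : 0 < polyVal (radialPoly f) (circlePoint r₀ t₀))
    (h : ∀ᶠ t in 𝓝[≠] t₀, polyVal f (circlePoint r₀ t₀) < polyVal f (circlePoint r₀ t)) :
    LevelInside f (circlePoint r₀ t₀) := by
  obtain ⟨ε, hε, -, hmono⟩ := exists_strictMonoOn_radius hr hE
  rw [eventually_nhdsWithin_iff] at h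
  have h2 := eventually_nhds_of_polar hr ((eventually_box hε).and
    ((continuous_snd.tendsto (r₀, t₀)).eventually h))
  rw [LevelInside, eventually_nhdsWithin_iff]
  filter_upwards [h2] with q hq hqne hfq
  obtain ⟨t, hqt, ⟨hρ, ht⟩, htt⟩ := hq
  rw [norm_circlePoint, abs_of_pos hr]
  by_contra! hle
  have h3 : polyVal f (circlePoint r₀ t) ≤ polyVal f (circlePoint ‖q‖ t) :=
    (hmono t ht).monotoneOn ⟨by linarith, by linarith⟩ hρ hle
  rw [hqt, hfq] at h3
  by_cases hne : t = t₀
  · subst hne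
    rcases hle.lt_or_eq with hlt | heq
    · have := hmono t ht ⟨by linarith, by linarith⟩ hρ hlt
      simp only [hqt, hfq, lt_irrefl] at this
    · exact hqne (by rw [Set.mem_singleton_iff, heq, hqt])
  · exact absurd (htt hne) (not_lt.2 h3)

lemma eventually_circlePoint_ne (hr : 0 < r₀) :
    ∀ᶠ t in 𝓝[≠] t₀, circlePoint r₀ t ≠ circlePoint r₀ t₀ := by
  rw [eventually_nhdsWithin_iff]
  filter_upwards [Metric.ball_mem_nhds t₀ Real.two_pi_pos] with t ht hne h
  exact hne (eq_of_circlePoint_eq hr.ne' h ht)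

/-- At angles arbitrarily close to `t₀` the value at radius `r₀` is at least the level, while
slightly further in it is below. The intermediate value theorem on the ray yields a point of the
level set, other than the base point, that is not outside the circle. -/
lemma not_levelOutside_of_frequently_le (hr : 0 < r₀)
    (hE : 0 < polyVal (radialPoly f) (circlePoint r₀ t₀))
    (h : ∃ᶠ t in 𝓝[≠] t₀, polyVal f (circlePoint r₀ t₀) ≤ polyVal f (circlePoint r₀ t)) :
    ¬ LevelOutside f (circlePoint r₀ t₀) := by
  intro hL
  obtain ⟨ε, hε, hεr, hmono⟩ := exists_strictMonoOn_radius hr hE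
  rw [LevelOutside, eventually_nhdsWithin_iff] at hL
  have hL2 := (continuous_circlePoint.tendsto (r₀, t₀)).eventually hL
  obtain ⟨δ, hδ, hball⟩ := Metric.eventually_nhds_iff.1 hL2
  obtain ⟨η, hη, hηε, hηδ⟩ : ∃ η > 0, η < ε ∧ η < δ :=
    ⟨min ε δ / 2, by positivity, by linarith [min_le_left ε δ, lt_min hε hδ],
      by linarith [min_le_right ε δ, lt_min hε hδ]⟩
  -- Strict inequality at the inner radius on the central ray persists on all nearby rays; `η < δ`
  -- keeps the point found within reach of `hball`.
  have h1 : polyVal f (circlePoint (r₀ - η) t₀) < polyVal f (circlePoint r₀ t₀) :=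
    hmono t₀ (by simpa) ⟨by linarith, by linarith⟩ ⟨by linarith, by linarith⟩ (by linarith)
  have hcont : Continuous fun x : ℝ × ℝ => polyVal f (circlePoint x.1 x.2) :=
    (continuous_polyVal _).comp continuous_circlePoint
  have h2 : ∀ᶠ t in 𝓝 t₀, polyVal f (circlePoint (r₀ - η) t) < polyVal f (circlePoint r₀ t₀) :=
    (hcont.comp (Continuous.prodMk_right (r₀ - η))).continuousAt.eventually (gt_mem_nhds h1)
  obtain ⟨t, ht1, ht2, ht3, ht4⟩ := (h.and_eventually ((eventually_nhdsWithin_of_eventually_nhds h2).and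
    ((eventually_nhdsWithin_of_eventually_nhds (Metric.ball_mem_nhds t₀ hδ)).and (eventually_circlePoint_ne hr)))).exists
  obtain ⟨ρ, hρ, hρ'⟩ := intermediate_value_Icc (by linarith : r₀ - η ≤ r₀)
    (hcont.comp (Continuous.prodMk_left t)).continuousOn ⟨ht2.le, ht1⟩
  have hρ'' : polyVal f (circlePoint ρ t) = polyVal f (circlePoint r₀ t₀) := hρ'
  have h3 : dist (ρ, t) (r₀, t₀) < δ := by
    rw [Prod.dist_eq]
    refine max_lt ?_ ht3
    rw [Real.dist_eq, abs_lt]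
    constructor <;> linarith [hρ.1, hρ.2]
  have hρ0 : 0 < ρ := by linarith [hρ.1]
  have h4 := hball h3 (fun h => ?_) hρ''
  · simp only [norm_circlePoint, abs_of_pos hr, abs_of_pos hρ0] at h4
    linarith [hρ.2]
  · have h5 : circlePoint ρ t = circlePoint r₀ t₀ := h
    have h6 := congrArg norm h5
    rw [norm_circlePoint, norm_circlePoint, abs_of_pos hr, abs_of_pos hρ0] at h6
    rw [h6] at h5
    exact ht4 h5

lemma not_levelInside_of_frequently_le (hr : 0 < r₀)
    (hE : 0 < polyVal (radialPoly f) (circlePoint r₀ t₀))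
    (h : ∃ᶠ t in 𝓝[≠] t₀, polyVal f (circlePoint r₀ t) ≤ polyVal f (circlePoint r₀ t₀)) :
    ¬ LevelInside f (circlePoint r₀ t₀) := by
  intro hL
  obtain ⟨ε, hε, hεr, hmono⟩ := exists_strictMonoOn_radius hr hE
  rw [LevelInside, eventually_nhdsWithin_iff] at hL
  have hL2 := (continuous_circlePoint.tendsto (r₀, t₀)).eventually hL
  obtain ⟨δ, hδ, hball⟩ := Metric.eventually_nhds_iff.1 hL2
  obtain ⟨η, hη, hηε, hηδ⟩ : ∃ η > 0, η < ε ∧ η < δ :=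
    ⟨min ε δ / 2, by positivity, by linarith [min_le_left ε δ, lt_min hε hδ],
      by linarith [min_le_right ε δ, lt_min hε hδ]⟩
  have h1 : polyVal f (circlePoint r₀ t₀) < polyVal f (circlePoint (r₀ + η) t₀) :=
    hmono t₀ (by simpa) ⟨by linarith, by linarith⟩ ⟨by linarith, by linarith⟩ (by linarith)
  have hcont : Continuous fun x : ℝ × ℝ => polyVal f (circlePoint x.1 x.2) :=
    (continuous_polyVal _).comp continuous_circlePoint
  have h2 : ∀ᶠ t in 𝓝 t₀, polyVal f (circlePoint r₀ t₀) < polyVal f (circlePoint (r₀ + η) t) :=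
    (hcont.comp (Continuous.prodMk_right (r₀ + η))).continuousAt.eventually (lt_mem_nhds h1)
  obtain ⟨t, ht1, ht2, ht3, ht4⟩ := (h.and_eventually ((eventually_nhdsWithin_of_eventually_nhds h2).and
    ((eventually_nhdsWithin_of_eventually_nhds (Metric.ball_mem_nhds t₀ hδ)).and (eventually_circlePoint_ne hr)))).exists
  obtain ⟨ρ, hρ, hρ'⟩ := intermediate_value_Icc (by linarith : r₀ ≤ r₀ + η)
    (hcont.comp (Continuous.prodMk_left t)).continuousOn ⟨ht1, ht2.le⟩
  have hρ'' : polyVal f (circlePoint ρ t) = polyVal f (circlePoint r₀ t₀) := hρ'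
  have h3 : dist (ρ, t) (r₀, t₀) < δ := by
    rw [Prod.dist_eq]
    refine max_lt ?_ ht3
    rw [Real.dist_eq, abs_lt]
    constructor <;> linarith [hρ.1, hρ.2]
  have hρ0 : 0 < ρ := by linarith [hρ.1]
  have h4 := hball h3 (fun h => ?_) hρ''
  · simp only [norm_circlePoint, abs_of_pos hr, abs_of_pos hρ0] at h4
    linarith [hρ.1]
  · have h5 : circlePoint ρ t = circlePoint r₀ t₀ := h
    have h6 := congrArg norm h5
    rw [norm_circlePoint, norm_circlePoint, abs_of_pos hr, abs_of_pos hρ0] at h6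
    rw [h6] at h5
    exact ht4 h5

end Local

/-- `f` and `-f` have the same level sets; this reduces the computation of the number to the case `E
> 0`. -/
lemma tangencyNumber_neg (f : MvPolynomial (Fin 2) ℝ) (q : Plane) :
    tangencyNumber (-f) q = tangencyNumber f q := by
  have h1 : LevelOutside (-f) q ↔ LevelOutside f q := by simp [LevelOutside]
  have h2 : LevelInside (-f) q ↔ LevelInside f q := by simp [LevelInside]
  rw [tangencyNumber, tangencyNumber, h1, h2]

lemma tangencyPoly_neg (f : MvPolynomial (Fin 2) ℝ) : tangencyPoly (-f) = -tangencyPoly f := by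
  simp [tangencyPoly]; ring

lemma radialPoly_neg (f : MvPolynomial (Fin 2) ℝ) : radialPoly (-f) = -radialPoly f := by
  simp [radialPoly]; ring

/-- `sL` and `sR` are the nonzero signs of `u` on the left and on the right of `t`. -/
structure HasSideSigns (u : ℝ → ℝ) (t : ℝ) (sL sR : SignType) : Prop where
  left_ne : sL ≠ 0
  right_ne : sR ≠ 0
  left : ∀ᶠ s in 𝓝[<] t, SignType.sign (u s) = sL
  right : ∀ᶠ s in 𝓝[>] t, SignType.sign (u s) = sR

lemma HasSideSigns.neg {u : ℝ → ℝ} {t : ℝ} {sL sR : SignType} (h : HasSideSigns u t sL sR) :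
    HasSideSigns (fun s => - u s) t (-sL) (-sR) :=
  ⟨by simpa using h.left_ne, by simpa using h.right_ne,
    h.left.mono fun s hs => by rw [Left.sign_neg, hs],
    h.right.mono fun s hs => by rw [Left.sign_neg, hs]⟩

lemma eventually_lt_right {u u' : ℝ → ℝ} {t : ℝ} (hu : ∀ s, HasDerivAt u (u' s) s)
    (h : ∀ᶠ s in 𝓝[>] t, 0 < u' s) : ∀ᶠ s in 𝓝[>] t, u t < u s := by
  obtain ⟨b, hb, hb'⟩ := mem_nhdsGT_iff_exists_Ioo_subset.1 h
  have hm : StrictMonoOn u (Set.Ico t b) := by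
    refine strictMonoOn_of_deriv_pos (convex_Ico _ _)
      (fun s _ => (hu s).continuousAt.continuousWithinAt) fun s hs => ?_
    rw [interior_Ico] at hs
    rw [(hu s).deriv]
    exact hb' hs
  filter_upwards [Ioo_mem_nhdsGT hb] with s hs
  exact hm ⟨le_rfl, hb⟩ ⟨hs.1.le, hs.2⟩ hs.1

lemma eventually_lt_left {u u' : ℝ → ℝ} {t : ℝ} (hu : ∀ s, HasDerivAt u (u' s) s)
    (h : ∀ᶠ s in 𝓝[<] t, 0 < u' s) : ∀ᶠ s in 𝓝[<] t, u s < u t := by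
  obtain ⟨b, hb, hb'⟩ := mem_nhdsLT_iff_exists_Ioo_subset.1 h
  have hm : StrictMonoOn u (Set.Ioc b t) := by
    refine strictMonoOn_of_deriv_pos (convex_Ioc _ _)
      (fun s _ => (hu s).continuousAt.continuousWithinAt) fun s hs => ?_
    rw [interior_Ioc] at hs
    rw [(hu s).deriv]
    exact hb' hs
  filter_upwards [Ioo_mem_nhdsLT hb] with s hs
  exact hm ⟨hs.1, hs.2.le⟩ ⟨hb, le_rfl⟩ hs.2

/-- Since `tangencyPoly f` is the derivative of `f` along the circle, the signs `+, -` give a strict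
local maximum (level curve outside), `-, +` a strict local minimum (inside), and equal signs a
strictly monotone restriction (neither). -/
lemma tangencyNumber_eq_of_pos {f : MvPolynomial (Fin 2) ℝ} {r t : ℝ} (hr : 0 < r)
    (hE : 0 < polyVal (radialPoly f) (circlePoint r t)) {sL sR : SignType}
    (hs : HasSideSigns (fun s => polyVal (tangencyPoly f) (circlePoint r s)) t sL sR) :
    tangencyNumber f (circlePoint r t) = ((sR : ℚ) - sL) / 4 := by
  have hd := hasDerivAt_polyVal_circlePoint f r
  have hd' : ∀ s, HasDerivAt (fun s => - polyVal f (circlePoint r s))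
    (-polyVal (tangencyPoly f) (circlePoint r s)) s := fun s => (hd s).neg
  have hdec : sL = 1 ∨ sL = -1 := by
    have := hs.left_ne; revert this; cases sL <;> decide
  have hdec' : sR = 1 ∨ sR = -1 := by
    have := hs.right_ne; revert this; cases sR <;> decide
  have hne : 𝓝[≠] t = 𝓝[<] t ⊔ 𝓝[>] t := (nhdsLT_sup_nhdsGT t).symm
  have hlt : 𝓝[<] t ≤ 𝓝[≠] t := hne ▸ le_sup_left
  have hgt : 𝓝[>] t ≤ 𝓝[≠] t := hne ▸ le_sup_right
  have hL := hs.left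
  have hR := hs.right
  rcases hdec with rfl | rfl <;> rcases hdec' with rfl | rfl <;>
    simp only [sign_eq_one_iff, sign_eq_neg_one_iff] at hL hR
  · have h1 := eventually_lt_left hd hL
    have h2 := eventually_lt_right hd hR
    have n1 := not_levelInside_of_frequently_le hr hE
      ((h1.mono fun _ h => h.le).frequently.filter_mono hlt)
    have n2 := not_levelOutside_of_frequently_le hr hE
      ((h2.mono fun _ h => h.le).frequently.filter_mono hgt)
    simp [tangencyNumber, n1, n2]
  · have h1 := eventually_lt_left hd hL
    have h2 := eventually_lt_right hd' (by simpa using hR)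
    have n1 : LevelOutside f (circlePoint r t) := levelOutside_of_eventually_lt hr hE (by
      rw [hne, eventually_sup]; exact ⟨h1, by simpa using h2⟩)
    simp [tangencyNumber, n1]
    norm_num
  · have h1 := eventually_lt_left hd' (by simpa using hL)
    have h2 := eventually_lt_right hd hR
    have n1 : LevelInside f (circlePoint r t) := levelInside_of_eventually_lt hr hE (by
      rw [hne, eventually_sup]; exact ⟨by simpa using h1, h2⟩)
    have n2 := not_levelOutside_of_frequently_le hr hE
      ((h2.mono fun _ h => h.le).frequently.filter_mono hgt)
    simp [tangencyNumber, n1, n2]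
    norm_num
  · have h1 := eventually_lt_left hd' (by simpa using hL)
    have h2 := eventually_lt_right hd' (by simpa using hR)
    have n1 := not_levelInside_of_frequently_le hr hE
      ((h2.mono fun _ h => (neg_lt_neg_iff.1 h).le).frequently.filter_mono hgt)
    have n2 := not_levelOutside_of_frequently_le hr hE
      ((h1.mono fun _ h => (neg_lt_neg_iff.1 h).le).frequently.filter_mono hlt)
    simp [tangencyNumber, n1, n2]

/-- Passing to `-f` flips the sign of `E` and both side signs, so the right-hand side is unchanged.
-/
lemma tangencyNumber_eq {f : MvPolynomial (Fin 2) ℝ} {r t : ℝ} (hr : 0 < r)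
    (hE : polyVal (radialPoly f) (circlePoint r t) ≠ 0) {sL sR : SignType}
    (hs : HasSideSigns (fun s => polyVal (tangencyPoly f) (circlePoint r s)) t sL sR) :
    tangencyNumber f (circlePoint r t) =
      (SignType.sign (polyVal (radialPoly f) (circlePoint r t)) : ℚ) * ((sR : ℚ) - sL) / 4 := by
  rcases hE.lt_or_gt with hneg | hpos
  · rw [sign_neg hneg, ← tangencyNumber_neg, tangencyNumber_eq_of_pos hr (sL := -sL) (sR := -sR)]
    · simp; ring
    · simpa [radialPoly_neg] using hneg
    · simpa [tangencyPoly_neg] using hs.neg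
  · rw [sign_pos hpos, tangencyNumber_eq_of_pos hr hpos hs]
    simp

lemma tangencyNumber_eq_zero_of_tangencyPoly_eq_zero {f : MvPolynomial (Fin 2) ℝ}
    (hT : tangencyPoly f = 0) {q : Plane} (hq : q ≠ 0) (hE : polyVal (radialPoly f) q ≠ 0) :
    tangencyNumber f q = 0 := by
  obtain ⟨t, ht⟩ := exists_circlePoint q
  have hr : 0 < ‖q‖ := norm_pos_iff.2 hq
  have key : ∀ f : MvPolynomial (Fin 2) ℝ, tangencyPoly f = 0 →
      0 < polyVal (radialPoly f) q → tangencyNumber f q = 0 := by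
    intro f hT hE
    rw [← ht] at hE ⊢
    have hc : ∀ s, polyVal f (circlePoint ‖q‖ s) = polyVal f (circlePoint ‖q‖ t) := by
      intro s
      refine is_const_of_deriv_eq_zero
        (fun s => (hasDerivAt_polyVal_circlePoint f ‖q‖ s).differentiableAt) (fun s => ?_) s t
      rw [(hasDerivAt_polyVal_circlePoint f ‖q‖ s).deriv, hT, polyVal_zero]
    have n1 := not_levelInside_of_frequently_le hr hE (Eventually.of_forall fun s => (hc s).le).frequently
    have n2 := not_levelOutside_of_frequently_le hr hE (Eventually.of_forall fun s => (hc s).ge).frequently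
    simp [tangencyNumber, n1, n2]
  rcases hE.lt_or_gt with hneg | hpos
  · rw [← tangencyNumber_neg]
    exact key _ (by rw [tangencyPoly_neg, hT, neg_zero]) (by simpa [radialPoly_neg] using hneg)
  · exact key f hT hpos

/-! ### Counting half-turns of an angle -/

lemma eq_of_forall_exists_int {X : Type*} [TopologicalSpace X] {s : Set X} (hs : IsPreconnected s)
    {u : X → ℝ} (hu : ContinuousOn u s) {c : ℝ} (hc : c ≠ 0) (h : ∀ x ∈ s, ∃ k : ℤ, u x = c * k)
    {x y : X} (hx : x ∈ s) (hy : y ∈ s) : u x = u y := by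
  have hd : IsDiscrete (Set.range ((↑) : ℤ → ℝ)) :=
    ⟨Int.isClosedEmbedding_coe_real.isEmbedding.toHomeomorph.symm.isEmbedding.discreteTopology⟩
  have h1 : u x / c = u y / c := by
    refine IsPreconnected.constant_of_mapsTo hs hd
      (f := fun x => u x / c) (hu.div_const c) (fun z hz => ?_) hx hy
    obtain ⟨k, hk⟩ := h z hz
    exact ⟨k, by simp [hk, hc]⟩
  field_simp at h1
  exact h1

lemma exists_int_of_sin_eq_zero {x : ℝ} (h : Real.sin x = 0) : ∃ k : ℤ, x = Real.pi * k := by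
  obtain ⟨k, hk⟩ := Real.sin_eq_zero_iff.1 h
  exact ⟨k, by rw [← hk]; ring⟩

/-- To change its integer part, `φ / π` must pass through an integer, which is a zero of `sin φ`. -/
lemma floor_eq_of_sin_ne_zero {φ : ℝ → ℝ} {a b : ℝ} (hφ : ContinuousOn φ (Set.Icc a b))
    (hab : a ≤ b) (h : ∀ t ∈ Set.Icc a b, Real.sin (φ t) ≠ 0) :
    ⌊φ b / Real.pi⌋ = ⌊φ a / Real.pi⌋ := by
  have hc : ContinuousOn (fun t => φ t / Real.pi) (Set.Icc a b) := hφ.div_const _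
  have key : ∀ k : ℤ, ∀ t ∈ Set.Icc a b, φ t / Real.pi ≠ k := by
    intro k t ht hk
    refine h t ht (Real.sin_eq_zero_iff.2 ⟨k, ?_⟩)
    rw [← hk]; field_simp
  rcases lt_trichotomy ⌊φ b / Real.pi⌋ ⌊φ a / Real.pi⌋ with hlt | heq | hgt
  · obtain ⟨t, ht, ht'⟩ := intermediate_value_Icc' hab hc
      (show ((⌊φ a / Real.pi⌋ : ℤ) : ℝ) ∈ Set.Icc (φ b / Real.pi) (φ a / Real.pi) from
        ⟨(Int.floor_lt.1 hlt).le, Int.floor_le _⟩)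
    exact absurd ht' (key _ t ht)
  · exact heq
  · obtain ⟨t, ht, ht'⟩ := intermediate_value_Icc hab hc
      (show ((⌊φ b / Real.pi⌋ : ℤ) : ℝ) ∈ Set.Icc (φ a / Real.pi) (φ b / Real.pi) from
        ⟨(Int.floor_lt.1 hgt).le, Int.floor_le _⟩)
    exact absurd ht' (key _ t ht)

lemma sign_sin_of_abs_lt {u : ℝ} (h : |u| < Real.pi) :
    SignType.sign (Real.sin u) = SignType.sign u := by
  rw [abs_lt] at h
  rcases lt_trichotomy u 0 with hu | hu | hu
  · rw [sign_neg hu, sign_neg (Real.sin_neg_of_neg_of_neg_pi_lt hu h.1)]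
  · simp [hu]
  · rw [sign_pos hu, sign_pos (Real.sin_pos_of_pos_of_lt_pi hu h.2)]

/-- The integer part of `φ / π` at `t` close to a zero `z` of `sin φ`. -/
lemma floor_eq_near_zero {z t : ℝ} {s : SignType} {k : ℤ} (hz : z = Real.pi * k)
    (ht : |t - z| < Real.pi) (hs : SignType.sign (Real.sin t) = s) (hs0 : s ≠ 0) :
    (⌊t / Real.pi⌋ : ℚ) = k + (SignType.sign (Real.cos z) * s - 1) / 2 := by
  have hsin : Real.sin z = 0 := Real.sin_eq_zero_iff.2 ⟨k, by rw [hz]; ring⟩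
  -- As `sin z = 0`, the addition formula shows that `sign (cos z) * s` is the sign of `t - z`. This
  -- decides whether the floor is `k` or `k - 1`.
  have h1 : Real.sin t = Real.sin (t - z) * Real.cos z := by
    conv_lhs => rw [← sub_add_cancel t z]
    rw [Real.sin_add, hsin]; ring
  have hcos : Real.cos z ≠ 0 := by
    intro h
    have := Real.sin_sq_add_cos_sq z
    rw [hsin, h] at this
    norm_num at this
  rw [h1, sign_mul, sign_sin_of_abs_lt ht] at hs
  have hcc : SignType.sign (Real.cos z) * s = SignType.sign (t - z) := by
    rw [← hs]
    have : SignType.sign (Real.cos z) ≠ 0 := sign_ne_zero.2 hcos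
    revert this
    generalize SignType.sign (Real.cos z) = x
    generalize SignType.sign (t - z) = y
    revert x y; decide
  have hne : t - z ≠ 0 := by
    intro h; rw [h] at hs; simp at hs; exact hs0 hs.symm
  have hcc' : (SignType.sign (Real.cos z) : ℚ) * s = SignType.sign (t - z) := by
    rw [← hcc]; simp
  rw [hcc']
  have hpi := Real.pi_pos
  rw [abs_lt] at ht
  rcases hne.lt_or_gt with h | h
  · have : ⌊t / Real.pi⌋ = k - 1 := by
      rw [Int.floor_eq_iff, le_div_iff₀ hpi, div_lt_iff₀ hpi]
      push_cast
      constructor <;> linarith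
    rw [this, sign_neg h]
    simp; ring
  · have : ⌊t / Real.pi⌋ = k := by
      rw [Int.floor_eq_iff, le_div_iff₀ hpi, div_lt_iff₀ hpi]
      constructor <;> linarith
    rw [this, sign_pos h]
    simp

/-- Induction on the largest zero `m`, with the right end `b` varying. Cutting at `c` and `d` just
before and after `m`, the inductive hypothesis covers `[a, c]`, the floor is constant on `[d, b]`,
and `floor_eq_near_zero` at `c` and `d` gives the jump across `m`. -/
lemma floor_sub_floor_eq_sum {φ : ℝ → ℝ} (hφ : Continuous φ) {sL sR : ℝ → SignType} {a : ℝ}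
    (Z : Finset ℝ) : ∀ b, a ≤ b → (∀ z ∈ Z, a < z ∧ z < b ∧ Real.sin (φ z) = 0 ∧
      HasSideSigns (fun t => Real.sin (φ t)) z (sL z) (sR z)) →
    (∀ t ∈ Set.Icc a b, Real.sin (φ t) = 0 → t ∈ Z) →
    (⌊φ b / Real.pi⌋ - ⌊φ a / Real.pi⌋ : ℚ) =
      ∑ z ∈ Z, (SignType.sign (Real.cos (φ z)) : ℚ) * (sR z - sL z) / 2 := by
  induction Z using Finset.induction_on_max with
  | empty =>
    intro b hab _ h
    rw [floor_eq_of_sin_ne_zero hφ.continuousOn hab fun t ht h0 => by simpa using h t ht h0]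
    simp
  | insert m Z hm ih =>
    intro b hab hZ h
    obtain ⟨ham, hmb, hsin, hs⟩ := hZ m (Finset.mem_insert_self _ _)
    obtain ⟨k, hk⟩ := exists_int_of_sin_eq_zero hsin
    have hnear : ∀ᶠ t in 𝓝 m, |φ t - φ m| < Real.pi :=
      hφ.continuousAt.eventually (p := fun y => |y - φ m| < Real.pi)
        (Metric.ball_mem_nhds (φ m) Real.pi_pos)
    have hleft : ∀ᶠ c in 𝓝[<] m, a < c ∧ ∀ z ∈ Z, z < c := by
      refine ((lt_mem_nhds ham).filter_mono nhdsWithin_le_nhds).and ?_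
      rw [Filter.eventually_all_finset]
      exact fun z hz => (lt_mem_nhds (hm z hz)).filter_mono nhdsWithin_le_nhds
    obtain ⟨c, ⟨hac, hZc⟩, hcs, hcn, hcm⟩ := (hleft.and (hs.left.and
      ((hnear.filter_mono nhdsWithin_le_nhds).and self_mem_nhdsWithin))).exists
    obtain ⟨d, hdb, hds, hdn, hmd⟩ := (((gt_mem_nhds hmb).filter_mono nhdsWithin_le_nhds).and
      (hs.right.and ((hnear.filter_mono nhdsWithin_le_nhds).and
        (self_mem_nhdsWithin : ∀ᶠ d in 𝓝[>] m, d ∈ Set.Ioi m)))).exists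
    have hcm' : c < m := hcm
    have hmd' : m < d := hmd
    have hmZ : m ∉ Z := fun h => lt_irrefl m (hm m h)
    have h1 := ih c hac.le (fun z hz => ⟨(hZ z (Finset.mem_insert_of_mem hz)).1, hZc z hz,
      (hZ z (Finset.mem_insert_of_mem hz)).2.2⟩) fun t ht h0 => by
        rcases Finset.mem_insert.1 (h t ⟨ht.1, by linarith [ht.2]⟩ h0) with rfl | h
        · linarith [ht.2]
        · exact h
    have h2 : ⌊φ b / Real.pi⌋ = ⌊φ d / Real.pi⌋ := by
      refine floor_eq_of_sin_ne_zero hφ.continuousOn hdb.le fun t ht h0 => ?_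
      rcases Finset.mem_insert.1 (h t ⟨by linarith [ht.1], ht.2⟩ h0) with rfl | h
      · linarith [ht.1]
      · linarith [hZc t h, ht.1]
    have h3 := floor_eq_near_zero hk hcn hcs hs.left_ne
    have h4 := floor_eq_near_zero hk hdn hds hs.right_ne
    rw [Finset.sum_insert hmZ, ← h1, h2, h3, h4]
    ring

/-! ### The index in terms of tangencies -/

/-- The angle is `φ t = θ t - t`, measured from the outward normal, which itself makes one turn;
hence `n - 1`. The factor `N` is `r` times the norm of the gradient. -/
lemma HasGradIndex.exists_angle {f : MvPolynomial (Fin 2) ℝ} {r : ℝ} {n : ℤ} (hr : 0 < r)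
    (H : HasGradIndex f r n) : ∃ φ : ℝ → ℝ, Continuous φ ∧
      (∀ t, φ (t + 2 * Real.pi) = φ t + 2 * Real.pi * (n - 1)) ∧
      ∀ t, ∃ N : ℝ, 0 < N ∧ polyVal (tangencyPoly f) (circlePoint r t) = N * Real.sin (φ t) ∧
        polyVal (radialPoly f) (circlePoint r t) = N * Real.cos (φ t) := by
  obtain ⟨hne, θ, hθ, hgrad, hn⟩ := H
  have hpos : ∀ t, 0 < ‖gradAt f (circlePoint r t)‖ := fun t => norm_pos_iff.2 (hne t)
  have hx : ∀ t, polyVal (pderiv 0 f) (circlePoint r t) =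
      ‖gradAt f (circlePoint r t)‖ * Real.cos (θ t) := fun t =>
    congrArg (fun v : Plane => v 0) (hgrad t)
  have hy : ∀ t, polyVal (pderiv 1 f) (circlePoint r t) =
      ‖gradAt f (circlePoint r t)‖ * Real.sin (θ t) := fun t =>
    congrArg (fun v : Plane => v 1) (hgrad t)
  -- The definition fixes the increment of `θ` only from `0` to `2π`. From any other starting point
  -- it is a multiple of `2π` depending continuously on the start, hence the same.
  have hper : ∀ t, θ (t + 2 * Real.pi) - θ t = 2 * Real.pi * n := by
    have hint : ∀ t ∈ Set.univ, ∃ k : ℤ, θ (t + 2 * Real.pi) - θ t = 2 * Real.pi * k := by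
      intro t _
      have h1 := hx (t + 2 * Real.pi)
      have h2 := hy (t + 2 * Real.pi)
      rw [circlePoint_add_two_pi] at h1 h2
      rw [hx t] at h1
      rw [hy t] at h2
      have h3 := mul_left_cancel₀ (hpos t).ne' h1
      have h4 := mul_left_cancel₀ (hpos t).ne' h2
      have h5 : Real.cos (θ (t + 2 * Real.pi) - θ t) = 1 := by
        rw [Real.cos_sub, ← h3, ← h4]
        linear_combination Real.sin_sq_add_cos_sq (θ t)
      obtain ⟨k, hk⟩ := (Real.cos_eq_one_iff _).1 h5
      exact ⟨k, by rw [← hk]; ring⟩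
    intro t
    rw [← hn]
    have := eq_of_forall_exists_int isPreconnected_univ
      (u := fun t => θ (t + 2 * Real.pi) - θ t) (by fun_prop) Real.two_pi_pos.ne' hint
      (Set.mem_univ t) (Set.mem_univ 0)
    simpa using this
  refine ⟨fun t => θ t - t, by fun_prop, fun t => ?_, fun t => ⟨r * ‖gradAt f (circlePoint r t)‖,
    mul_pos hr (hpos t), ?_, ?_⟩⟩
  · linear_combination hper t
  · rw [polyVal_tangencyPoly, hx, hy, Real.sin_sub]
    simp only [circlePoint_zero_coord, circlePoint_one_coord]
    ring
  · rw [polyVal_radialPoly, hx, hy, Real.cos_sub]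
    simp only [circlePoint_zero_coord, circlePoint_one_coord]
    ring

lemma HasGradIndex.eq_one {f : MvPolynomial (Fin 2) ℝ} {r : ℝ} {n : ℤ} (hr : 0 < r)
    (H : HasGradIndex f r n) (hT : tangencyPoly f = 0) : n = 1 := by
  obtain ⟨φ, hφ, hper, hN⟩ := H.exists_angle hr
  have h0 : φ (0 + 2 * Real.pi) = φ 0 := by
    refine eq_of_forall_exists_int isPreconnected_univ hφ.continuousOn Real.pi_pos.ne'
      (fun t _ => exists_int_of_sin_eq_zero ?_) (Set.mem_univ _) (Set.mem_univ _)
    obtain ⟨N, hN0, h1, -⟩ := hN t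
    rw [hT, polyVal_zero, eq_comm, mul_eq_zero] at h1
    exact h1.resolve_left hN0.ne'
  rw [hper] at h0
  have h1 : 2 * Real.pi * ((n : ℝ) - 1) = 0 := by linarith
  have h2 : (n : ℝ) - 1 = 0 := (mul_eq_zero.1 h1).resolve_left Real.two_pi_pos.ne'
  exact_mod_cast (sub_eq_zero.1 h2)

/-- Over one period `⌊φ/π⌋` grows by `2(n - 1)`, and each tangency accounts for twice its number. -/
theorem HasGradIndex.eq_sum {f : MvPolynomial (Fin 2) ℝ} {r : ℝ} {n : ℤ} (hr : 0 < r)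
    (H : HasGradIndex f r n) (Q : Finset Plane)
    (hQ : ∀ q, q ∈ Q ↔ polyVal (tangencyPoly f) q = 0 ∧ ‖q‖ = r)
    (hs : ∀ t, polyVal (tangencyPoly f) (circlePoint r t) = 0 → ∃ sL sR,
      HasSideSigns (fun s => polyVal (tangencyPoly f) (circlePoint r s)) t sL sR) :
    (n : ℚ) = 1 + ∑ q ∈ Q, tangencyNumber f q := by
  obtain ⟨φ, hφ, hper, hN⟩ := H.exists_angle hr
  have hpi := Real.two_pi_pos
  choose N hN0 hNT hNE using hN
  have hsin : ∀ t, Real.sin (φ t) = 0 ↔ polyVal (tangencyPoly f) (circlePoint r t) = 0 := fun t => by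
    rw [hNT, mul_eq_zero, or_iff_right (hN0 t).ne']
  have hmem : ∀ t, circlePoint r t ∈ Q ↔ Real.sin (φ t) = 0 := fun t => by
    rw [hQ, norm_circlePoint, abs_of_pos hr, hsin]; simp
  have hinj : ∀ a, Set.InjOn (circlePoint r) (Set.Ico a (a + 2 * Real.pi)) := by
    intro a s hs t ht hst
    refine eq_of_circlePoint_eq hr.ne' hst (abs_lt.2 ⟨?_, ?_⟩) <;> linarith [hs.1, hs.2, ht.1, ht.2]
  have hfin : ∀ a, {t | t ∈ Set.Ico a (a + 2 * Real.pi) ∧ circlePoint r t ∈ Q}.Finite := by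
    intro a
    refine Set.Finite.of_finite_image (f := circlePoint r) (Q.finite_toSet.subset ?_)
      ((hinj a).mono fun t ht => ht.1)
    rintro _ ⟨t, ht, rfl⟩
    exact ht.2
  -- The period is started at an angle that is not a tangency, so that no zero of `sin φ` sits at an
  -- end of the interval; one exists since a period contains only finitely many tangencies.
  obtain ⟨a, ha, haQ⟩ : ∃ a ∈ Set.Ico (0 : ℝ) (0 + 2 * Real.pi), circlePoint r a ∉ Q := by
    by_contra! hcon
    exact (Set.Ico_infinite (by linarith : (0 : ℝ) < 0 + 2 * Real.pi))
      ((hfin 0).subset fun t ht => ⟨ht, hcon t ht⟩)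
  have hsign : ∀ t, SignType.sign (polyVal (tangencyPoly f) (circlePoint r t)) =
      SignType.sign (Real.sin (φ t)) := fun t => by
    rw [hNT, sign_mul, sign_pos (hN0 t), one_mul]
  have hsignE : ∀ t, SignType.sign (polyVal (radialPoly f) (circlePoint r t)) =
      SignType.sign (Real.cos (φ t)) := fun t => by
    rw [hNE, sign_mul, sign_pos (hN0 t), one_mul]
  choose! sL sR hLR using hs
  have hcount := floor_sub_floor_eq_sum hφ (sL := sL) (sR := sR) (a := a) (hfin a).toFinset
    (a + 2 * Real.pi) (by linarith) (fun z hz => ?_) (fun t ht h0 => ?_)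
  · rw [hper] at hcount
    have hfl : ⌊(φ a + 2 * Real.pi * (n - 1)) / Real.pi⌋ = ⌊φ a / Real.pi⌋ + 2 * (n - 1) := by
      rw [← Int.floor_add_intCast]
      congr 1
      push_cast
      field_simp
    rw [hfl] at hcount
    have hsum : ∑ q ∈ Q, tangencyNumber f q = ∑ z ∈ (hfin a).toFinset,
        (SignType.sign (Real.cos (φ z)) : ℚ) * (sR z - sL z) / 4 := by
      refine (Finset.sum_bij (fun t _ => circlePoint r t) (fun t ht => ?_) (fun s hs t ht => ?_)
        (fun q hq => ?_) (fun t ht => ?_)).symm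
      · exact ((hfin a).mem_toFinset.1 ht).2
      · exact hinj a ((hfin a).mem_toFinset.1 hs).1 ((hfin a).mem_toFinset.1 ht).1
      · obtain ⟨t, ht⟩ := exists_circlePoint q
        rw [((hQ q).1 hq).2] at ht
        have h1 : circlePoint r (toIcoMod hpi a t) = q := by
          rw [← ht, toIcoMod, zsmul_eq_mul, circlePoint, Real.cos_sub_int_mul_two_pi,
            Real.sin_sub_int_mul_two_pi, circlePoint]
        exact ⟨toIcoMod hpi a t, (hfin a).mem_toFinset.2 ⟨toIcoMod_mem_Ico hpi a t, by rwa [h1]⟩, h1⟩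
      · have h0 := (hmem t).1 ((hfin a).mem_toFinset.1 ht).2
        rw [← hsignE, tangencyNumber_eq hr _ (hLR t ((hsin t).1 h0))]
        intro hE
        rw [hNE, mul_eq_zero, or_iff_right (hN0 t).ne'] at hE
        have := Real.sin_sq_add_cos_sq (φ t)
        rw [hE, h0] at this
        norm_num at this
    have h4 : ∑ z ∈ (hfin a).toFinset, (SignType.sign (Real.cos (φ z)) : ℚ) * (sR z - sL z) / 2 =
        2 * ∑ z ∈ (hfin a).toFinset, (SignType.sign (Real.cos (φ z)) : ℚ) * (sR z - sL z) / 4 := by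
      rw [Finset.mul_sum]
      exact Finset.sum_congr rfl fun z _ => by ring
    rw [h4, ← hsum] at hcount
    push_cast at hcount
    linarith
  · obtain ⟨⟨hz1, hz2⟩, hzQ⟩ := (hfin a).mem_toFinset.1 hz
    have h0 := (hmem z).1 hzQ
    have h1 := hLR z ((hsin z).1 h0)
    refine ⟨lt_of_le_of_ne hz1 fun h => haQ (h ▸ hzQ), hz2, h0, h1.left_ne, h1.right_ne,
      h1.left.mono fun s hs => by rw [← hsign, hs], h1.right.mono fun s hs => by rw [← hsign, hs]⟩
  · refine (hfin a).mem_toFinset.2 ⟨⟨ht.1, lt_of_le_of_ne ht.2 fun h => haQ ?_⟩, (hmem t).2 h0⟩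
    rw [h] at h0
    rw [← circlePoint_add_two_pi]
    exact (hmem _).2 h0

/-! ### Existence and invariance of the index -/

/-- On the convex set of pairs `(ρ, t)` with `ρ > ρ₀`, the nonvanishing function `f_x + i f_y` has a
continuous logarithm, whose imaginary part is an angle of the gradient. Its increment over a turn is
a multiple of `2π` continuous in `ρ`, so one integer serves all circles. -/
theorem exists_hasGradIndex {f : MvPolynomial (Fin 2) ℝ} {ρ₀ : ℝ} (hρ₀ : 0 ≤ ρ₀)
    (hcrit : ∀ q ∈ critSet f, ‖q‖ ≤ ρ₀) : ∃ n : ℤ, ∀ ρ > ρ₀, HasGradIndex f ρ n := by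
  let U : Set (ℝ × ℝ) := Set.Ioi ρ₀ ×ˢ Set.univ
  have hUc : Convex ℝ U := (convex_Ioi ρ₀).prod convex_univ
  have hUo : IsOpen U := isOpen_Ioi.prod isOpen_univ
  let g : ℝ × ℝ → ℂ := fun x => ((polyVal (pderiv 0 f) (circlePoint x.1 x.2) : ℝ) : ℂ) +
    ((polyVal (pderiv 1 f) (circlePoint x.1 x.2) : ℝ) : ℂ) * Complex.I
  have hg : Continuous g := by
    have h1 := (continuous_polyVal (pderiv 0 f)).comp continuous_circlePoint
    have h2 := (continuous_polyVal (pderiv 1 f)).comp continuous_circlePoint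
    exact (Complex.continuous_ofReal.comp h1).add
      ((Complex.continuous_ofReal.comp h2).mul continuous_const)
  have hgre : ∀ x, (g x).re = polyVal (pderiv 0 f) (circlePoint x.1 x.2) := by intro x; simp [g]
  have hgim : ∀ x, (g x).im = polyVal (pderiv 1 f) (circlePoint x.1 x.2) := by intro x; simp [g]
  have hne : ∀ ρ > ρ₀, ∀ t, circlePoint ρ t ∉ critSet f := by
    intro ρ hρ t h
    have := hcrit _ h
    rw [norm_circlePoint, abs_of_pos (by linarith)] at this
    linarith
  have hg0 : 0 ∉ g '' U := by
    rintro ⟨x, hx, hx0⟩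
    refine hne x.1 hx.1 x.2 (mem_critSet.2 ⟨?_, ?_⟩)
    · rw [← hgre, hx0]; rfl
    · rw [← hgim, hx0]; rfl
  have hUsc : IsSimplyConnected U := by
    have := hUc.contractibleSpace ⟨(ρ₀ + 1, 0), by simp [U]⟩
    exact (inferInstance : SimplyConnectedSpace U)
  obtain ⟨F, hF, hFg⟩ := Complex.exists_continuousOn_eqOn_exp_comp hUsc hUo hg.continuousOn hg0
  have hexp : ∀ ρ > ρ₀, ∀ t, Complex.exp (F (ρ, t)) = g (ρ, t) := fun ρ hρ t =>
    hFg (⟨hρ, trivial⟩ : (ρ, t) ∈ U)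
  have hcontF : ∀ t, ContinuousOn (fun ρ => (F (ρ, t)).im) (Set.Ioi ρ₀) := fun t =>
    Complex.continuous_im.comp_continuousOn
      (hF.comp (Continuous.prodMk_left t).continuousOn fun ρ hρ => ⟨hρ, trivial⟩)
  have hint : ∀ ρ ∈ Set.Ioi ρ₀, ∃ k : ℤ,
      (F (ρ, 2 * Real.pi)).im - (F (ρ, 0)).im = 2 * Real.pi * k := by
    intro ρ hρ
    have h1 : Complex.exp (F (ρ, 2 * Real.pi)) = Complex.exp (F (ρ, 0)) := by
      rw [hexp ρ hρ, hexp ρ hρ]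
      have := circlePoint_add_two_pi ρ 0
      rw [zero_add] at this
      simp only [g, this]
    obtain ⟨k, hk⟩ := Complex.exp_eq_exp_iff_exists_int.1 h1
    refine ⟨k, ?_⟩
    rw [hk]
    simp; ring
  obtain ⟨n, hn⟩ := hint (ρ₀ + 1) (by simp)
  refine ⟨n, fun ρ hρ => ⟨fun t h => hne ρ hρ t h, fun t => (F (ρ, t)).im, ?_, fun t => ?_, ?_⟩⟩
  · exact Complex.continuous_im.comp
      (hF.comp_continuous (Continuous.prodMk_right ρ) fun t => ⟨hρ, trivial⟩)
  · have h1 := hexp ρ hρ t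
    have hnorm : ‖gradAt f (circlePoint ρ t)‖ = Real.exp (F (ρ, t)).re := by
      rw [← Complex.norm_exp, h1, ← sq_eq_sq₀ (norm_nonneg _) (norm_nonneg _), norm_sq_plane,
        Complex.sq_norm, Complex.normSq_apply, hgre, hgim]
      simp [gradAt]
      ring
    rw [hnorm]
    ext i; fin_cases i
    · change polyVal (pderiv 0 f) (circlePoint ρ t) = _ * Real.cos _
      rw [← Complex.exp_re, h1, hgre]
    · change polyVal (pderiv 1 f) (circlePoint ρ t) = _ * Real.sin _
      rw [← Complex.exp_im, h1, hgim]
  · rw [← hn]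
    exact eq_of_forall_exists_int isPreconnected_Ioi
      (u := fun ρ => (F (ρ, 2 * Real.pi)).im - (F (ρ, 0)).im)
      ((hcontF _).sub (hcontF _)) Real.two_pi_pos.ne' hint hρ (by simp)

/-! ### Limits along arcs -/

/-- A function without a limit in `EReal` crosses some interval infinitely often, and so takes every
value in it at arbitrarily large `r`. The hypothesis permits this for at most one value. -/
lemma exists_tendsto_ereal {u : ℝ → ℝ} {R : ℝ} (hu : ContinuousOn u (Set.Ioi R)) {B : Set ℝ}
    (hB : B.Subsingleton) (h : ∀ c ∉ B, ∀ᶠ r in atTop, u r ≠ c) :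
    ∃ c : EReal, Tendsto (fun r => (u r : EReal)) atTop (𝓝 c) := by
  refine tendsto_of_no_upcrossings dense_univ fun a _ b _ hab => ?_
  rintro ⟨ha, hb⟩
  obtain ⟨c₁, hc₁, hc₁'⟩ := EReal.lt_iff_exists_real_btwn.1 hab
  obtain ⟨c₂, hc₂, hc₂'⟩ := EReal.lt_iff_exists_real_btwn.1 hc₁'
  -- Of the two distinct reals `c₁ < c₂` strictly between `a` and `b`, at most one is exceptional.
  obtain ⟨c, hcB, hac, hcb⟩ : ∃ c : ℝ, c ∉ B ∧ a < c ∧ (c : EReal) < b := by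
    by_cases h1 : c₁ ∈ B
    · refine ⟨c₂, fun h2 => ?_, hc₁.trans hc₂, hc₂'⟩
      rw [hB h1 h2] at hc₂
      exact lt_irrefl _ hc₂
    · exact ⟨c₁, h1, hc₁, hc₁'⟩
  obtain ⟨R', hR'⟩ := eventually_atTop.1 ((h c hcB).and (eventually_gt_atTop R))
  obtain ⟨x, hx, hxR⟩ := (ha.and_eventually (eventually_ge_atTop R')).exists
  obtain ⟨y, hy, hyR⟩ := (hb.and_eventually (eventually_ge_atTop R')).exists
  have hcont : ContinuousOn u (Set.Ici R') := hu.mono fun r hr => (hR' r hr).2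
  have hx' : u x < c := by exact_mod_cast hx.trans hac
  have hy' : c < u y := by exact_mod_cast hcb.trans hy
  obtain ⟨z, hz, hz'⟩ := isPreconnected_Ici.intermediate_value (Set.mem_Ici.2 hxR)
    (Set.mem_Ici.2 hyR) hcont ⟨hx'.le, hy'.le⟩
  exact (hR' z hz).1 hz'

lemma exists_tendsto_onePoint {u : ℝ → ℝ} {l : Filter ℝ} {c : EReal}
    (h : Tendsto (fun r => (u r : EReal)) l (𝓝 c)) :
    ∃ c' : OnePoint ℝ, Tendsto (fun r => (u r : OnePoint ℝ)) l (𝓝 c') := by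
  induction c with
  | bot =>
    refine ⟨OnePoint.infty, OnePoint.tendsto_coe_infty.comp ?_⟩
    exact (EReal.tendsto_coe_nhds_bot_iff.1 h).mono_right (by
      rw [coclosedCompact_eq_cocompact]; exact atBot_le_cocompact)
  | top =>
    refine ⟨OnePoint.infty, OnePoint.tendsto_coe_infty.comp ?_⟩
    exact (EReal.tendsto_coe_nhds_top_iff.1 h).mono_right (by
      rw [coclosedCompact_eq_cocompact]; exact atTop_le_cocompact)
  | coe x =>
    exact ⟨x, (OnePoint.continuous_coe.tendsto x).comp (EReal.tendsto_coe.1 h)⟩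

lemma exists_tendsto_of_abs_le {u : ℝ → ℝ} {l : Filter ℝ} [l.NeBot] {c : EReal} {K : ℝ}
    (h : Tendsto (fun r => (u r : EReal)) l (𝓝 c)) (hK : ∀ᶠ r in l, |u r| ≤ K) :
    ∃ c' : ℝ, Tendsto u l (𝓝 c') := by
  induction c with
  | bot =>
    have h1 := EReal.tendsto_coe_nhds_bot_iff.1 h
    obtain ⟨r, h2, h3⟩ := ((h1.eventually_lt_atBot (-K)).and hK).exists
    linarith [(abs_le.1 h3).1]
  | top =>
    have h1 := EReal.tendsto_coe_nhds_top_iff.1 h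
    obtain ⟨r, h2, h3⟩ := ((h1.eventually_gt_atTop K).and hK).exists
    linarith [(abs_le.1 h3).2]
  | coe x => exact ⟨x, EReal.tendsto_coe.1 h⟩

lemma IsArc.continuousOn_polyVal {h : MvPolynomial (Fin 2) ℝ} {R : ℝ} {σ : ℝ → Plane}
    (hσ : IsArc h R σ) (A : MvPolynomial (Fin 2) ℝ) :
    ContinuousOn (fun r => polyVal A (σ r)) (Set.Ioi R) :=
  (continuous_polyVal A).comp_continuousOn hσ.continuousOn

lemma IsArc.eventually_ne {h A : MvPolynomial (Fin 2) ℝ} (hh : Irreducible h) {R : ℝ}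
    {σ : ℝ → Plane} (hσ : IsArc h R σ) (hA : ¬ h ∣ A) : ∀ᶠ r in atTop, polyVal A (σ r) ≠ 0 := by
  obtain ⟨R', hR'⟩ := (eventually_ne_zero_of_not_dvd hh hA).exists
  filter_upwards [eventually_gt_atTop R, eventually_gt_atTop R'] with r h1 h2
  exact hR' _ (by rwa [hσ.norm_eq r h1]) (hσ.polyVal_eq r h1)

/-- The quotient equals `c` exactly where `A - cB` vanishes, which stops happening far out unless
`h` divides `A - cB`. Two such constants would make `h` divide a nonzero multiple of `B`, which has
no zero on the arc. -/
lemma IsArc.exists_tendsto_div {h : MvPolynomial (Fin 2) ℝ} (hh : Irreducible h) {R : ℝ}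
    {σ : ℝ → Plane} (hσ : IsArc h R σ) (A B : MvPolynomial (Fin 2) ℝ)
    (hB : ∀ r > R, polyVal B (σ r) ≠ 0) :
    ∃ c : EReal, Tendsto (fun r => ((polyVal A (σ r) / polyVal B (σ r) : ℝ) : EReal))
      atTop (𝓝 c) := by
  refine exists_tendsto_ereal ((hσ.continuousOn_polyVal A).div (hσ.continuousOn_polyVal B) hB)
    (B := {c | h ∣ A - C c * B}) (fun c hc d hd => ?_) fun c hc => ?_
  · by_contra hne
    have h1 : h ∣ C (d - c) * B := by
      have := dvd_sub hc hd
      rwa [show A - C c * B - (A - C d * B) = C (d - c) * B by rw [C_sub]; ring] at this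
    obtain ⟨k, hk⟩ := h1
    have h2 := hB (R + 1) (by simp)
    have h3 := congrArg (fun p => polyVal p (σ (R + 1))) hk
    simp only [polyVal_mul, polyVal_C, hσ.polyVal_eq (R + 1) (by simp), zero_mul, mul_eq_zero, h2,
      or_false, sub_eq_zero] at h3
    exact hne h3.symm
  · filter_upwards [hσ.eventually_ne hh hc, eventually_gt_atTop R] with r h1 h2 h3
    rw [div_eq_iff (hB r h2)] at h3
    simp [h3] at h1

lemma IsArc.exists_limitValue {h : MvPolynomial (Fin 2) ℝ} (hh : Irreducible h) {R : ℝ}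
    {σ : ℝ → Plane} (hσ : IsArc h R σ) (f : MvPolynomial (Fin 2) ℝ) :
    ∃ c : OnePoint ℝ, Tendsto (fun r => (polyVal f (σ r) : OnePoint ℝ)) atTop (𝓝 c) := by
  obtain ⟨c, hc⟩ := hσ.exists_tendsto_div hh f 1 (by simp)
  simp only [polyVal_one, div_one] at hc
  exact exists_tendsto_onePoint hc

/-! ### The real projective plane -/

lemma continuous_rp2_mk : Continuous fun v : {v : Fin 3 → ℝ // v ≠ 0} =>
    (Projectivization.mk ℝ v.1 v.2 : RP2) :=
  continuous_coinduced_rng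

lemma tendsto_rp2_mk {l : Filter ℝ} {v : ℝ → Fin 3 → ℝ} {w : Fin 3 → ℝ} (hv : ∀ r, v r ≠ 0)
    (hw : w ≠ 0) (h : Tendsto v l (𝓝 w)) :
    Tendsto (fun r => (Projectivization.mk ℝ (v r) (hv r) : RP2)) l
      (𝓝 (Projectivization.mk ℝ w hw)) := by
  have h1 : Tendsto (fun r => (⟨v r, hv r⟩ : {v : Fin 3 → ℝ // v ≠ 0})) l (𝓝 ⟨w, hw⟩) :=
    tendsto_subtype_rng.2 h
  exact (continuous_rp2_mk.tendsto _).comp h1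

/-- The orthogonal projection onto a line, as a matrix. -/
def RP2.toMatrix : RP2 → Fin 3 → Fin 3 → ℝ :=
  Projectivization.lift (fun v i j => v.1 i * v.1 j / (v.1 ⬝ᵥ v.1)) (by
    rintro ⟨a, ha⟩ ⟨b, hb⟩ t hab
    have hab : a = t • b := hab
    have ht : t ≠ 0 := by rintro rfl; simp at hab; exact ha hab
    have hbb : b ⬝ᵥ b ≠ 0 := fun h => hb (dotProduct_self_eq_zero.1 h)
    ext i j
    simp only [hab, Pi.smul_apply, smul_eq_mul, smul_dotProduct, dotProduct_smul]
    field_simp)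

lemma RP2.toMatrix_mk (v : Fin 3 → ℝ) (hv : v ≠ 0) (i j : Fin 3) :
    RP2.toMatrix (Projectivization.mk ℝ v hv) i j = v i * v j / (v ⬝ᵥ v) := rfl

lemma RP2.continuous_toMatrix : Continuous RP2.toMatrix := by
  refine continuous_coinduced_dom.2 ?_
  refine continuous_pi fun i => continuous_pi fun j => ?_
  change Continuous fun v : {v : Fin 3 → ℝ // v ≠ 0} => v.1 i * v.1 j / (v.1 ⬝ᵥ v.1)
  have hc : ∀ k, Continuous fun v : {v : Fin 3 → ℝ // v ≠ 0} => v.1 k := fun k =>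
    (continuous_apply k).comp continuous_subtype_val
  refine Continuous.div ((hc i).mul (hc j)) ?_ fun v h => v.2 (dotProduct_self_eq_zero.1 h)
  exact continuous_finsetSum _ fun k _ => (hc k).mul (hc k)

/-- A nonzero column of the projection matrix spans the line. -/
lemma RP2.toMatrix_injective : Function.Injective RP2.toMatrix := by
  intro p p' h
  induction p using Projectivization.ind with | h v hv =>
  induction p' using Projectivization.ind with | h w hw =>
  have hvv : v ⬝ᵥ v ≠ 0 := fun h => hv (dotProduct_self_eq_zero.1 h)
  have hww : w ⬝ᵥ w ≠ 0 := fun h => hw (dotProduct_self_eq_zero.1 h)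
  have h1 : ∀ i j, v i * v j / (v ⬝ᵥ v) = w i * w j / (w ⬝ᵥ w) := fun i j => by
    rw [← RP2.toMatrix_mk v hv, ← RP2.toMatrix_mk w hw, h]
  obtain ⟨k, hk⟩ := Function.ne_iff.1 hv
  have hk' : v k ≠ 0 := hk
  rw [Projectivization.mk_eq_mk_iff']
  refine ⟨w k * (v ⬝ᵥ v) / (w ⬝ᵥ w) / v k, ?_⟩
  ext i
  have h2 := h1 i k
  simp only [Pi.smul_apply, smul_eq_mul]
  field_simp at h2 ⊢
  linarith

/-- The Hausdorff property makes the endpoint of an end unique. -/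
instance RP2.instT2Space : T2Space RP2 :=
  .of_injective_continuous RP2.toMatrix_injective RP2.continuous_toMatrix

lemma toRP2_eq_mk_smul (q : Plane) {t : ℝ} (ht : t ≠ 0) :
    toRP2 q = Projectivization.mk ℝ ![t * q 0, t * q 1, t] (fun h => ht (congrFun h 2)) := by
  rw [toRP2, Projectivization.mk_eq_mk_iff']
  refine ⟨t⁻¹, ?_⟩
  ext i; fin_cases i <;> simp [ht]

/-- The homogeneous coordinates `[x, y, 1]` are multiplied by `σ r k / r ^ 2`, after which the first
two tend to `a` and `b` and the third to `0`. Quadratic expressions over `r ^ 2` are used because,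
unlike `x / r`, they are rational functions of the point. -/
lemma exists_tendsto_toRP2 {σ : ℝ → Plane} {a b : ℝ} (k : Fin 2) (ht : ∀ᶠ r in atTop, ‖σ r‖ = r)
    (ha : Tendsto (fun r => σ r k * σ r 0 / r ^ 2) atTop (𝓝 a))
    (hb : Tendsto (fun r => σ r k * σ r 1 / r ^ 2) atTop (𝓝 b)) (hab : ![a, b] k ≠ 0) :
    ∃ p ∈ lineAtInfinity, Tendsto (fun r => toRP2 (σ r)) atTop (𝓝 p) := by
  have hne : ![a, b, 0] ≠ (0 : Fin 3 → ℝ) := by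
    intro h
    apply hab
    fin_cases k
    · exact congrFun h 0
    · exact congrFun h 1
  have h0 : Tendsto (fun r => σ r k / r ^ 2) atTop (𝓝 0) := by
    refine squeeze_zero_norm' (a := fun r : ℝ => r⁻¹) ?_ tendsto_inv_atTop_zero
    filter_upwards [ht, eventually_gt_atTop 0] with r h1 h2
    rw [norm_div, norm_pow, Real.norm_of_nonneg h2.le, div_le_iff₀ (by positivity)]
    calc ‖σ r k‖ ≤ ‖σ r‖ := PiLp.norm_apply_le (σ r) k
      _ = r⁻¹ * r ^ 2 := by rw [h1]; field_simp
  have hk : ∀ᶠ r in atTop, σ r k ≠ 0 := by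
    have h1 : Tendsto (fun r => σ r k * σ r k / r ^ 2) atTop (𝓝 (![a, b] k)) := by
      fin_cases k
      · exact ha
      · exact hb
    filter_upwards [h1.eventually_ne hab] with r hr h
    simp [h] at hr
  have hv : ∀ r, ![σ r k * σ r 0 / r ^ 2, σ r k * σ r 1 / r ^ 2,
      if σ r k / r ^ 2 = 0 then 1 else σ r k / r ^ 2] ≠ (0 : Fin 3 → ℝ) := by
    intro r h
    have := congrFun h 2
    simp only [Matrix.cons_val, Pi.zero_apply] at this
    split_ifs at this with h1
    · norm_num at this
    · exact h1 this
  refine ⟨Projectivization.mk ℝ ![a, b, 0] hne, ⟨a, b, hne, rfl⟩, ?_⟩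
  refine (tendsto_rp2_mk hv hne ?_).congr' ?_
  · refine tendsto_pi_nhds.2 fun i => ?_
    fin_cases i
    · exact ha
    · exact hb
    · refine h0.congr' ?_
      filter_upwards [hk, eventually_gt_atTop 0] with r h1 h2
      have : σ r k / r ^ 2 ≠ 0 := by positivity
      simp [this]
  · filter_upwards [hk, eventually_gt_atTop 0] with r h1 h2
    have h3 : σ r k / r ^ 2 ≠ 0 := by positivity
    rw [toRP2_eq_mk_smul _ h3]
    congr 1
    ext i; fin_cases i <;> simp [h3] <;> ring

/-- Each `x_i x_j / r ^ 2` is a quotient of polynomials bounded by 1 on the arc, so it has a finite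
limit. The two diagonal limits `a` and `d` add up to 1, so one is nonzero and selects the coordinate
used for rescaling. -/
lemma IsArc.exists_endpoint {h : MvPolynomial (Fin 2) ℝ} (hh : Irreducible h) {R : ℝ} (hR : 0 ≤ R)
    {σ : ℝ → Plane} (hσ : IsArc h R σ) :
    ∃ p ∈ lineAtInfinity, Tendsto (fun r => toRP2 (σ r)) atTop (𝓝 p) := by
  have hB : ∀ r > R, polyVal (X 0 * X 0 + X 1 * X 1) (σ r) = r ^ 2 := fun r hr => by
    have := norm_sq_plane (σ r)
    rw [hσ.norm_eq r hr] at this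
    simp [this, pow_two]
  have key : ∀ i j : Fin 2, ∃ c, Tendsto (fun r => σ r i * σ r j / r ^ 2) atTop (𝓝 c) := by
    intro i j
    obtain ⟨c, hc⟩ := hσ.exists_tendsto_div hh (X i * X j) (X 0 * X 0 + X 1 * X 1) fun r hr => by
      rw [hB r hr]
      have : 0 < r := hR.trans_lt hr
      positivity
    obtain ⟨c', hc'⟩ := exists_tendsto_of_abs_le hc (K := 1) (by
      filter_upwards [eventually_gt_atTop R] with r hr
      have h0 : 0 < r := hR.trans_lt hr
      rw [hB r hr, polyVal_mul, polyVal_X, polyVal_X, abs_div, abs_mul, abs_of_pos (by positivity : 0 < r ^ 2),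
        div_le_one (by positivity), pow_two]
      have h1 : ∀ k, |σ r k| ≤ r := fun k => (PiLp.norm_apply_le (σ r) k).trans (hσ.norm_eq r hr).le
      exact mul_le_mul (h1 i) (h1 j) (abs_nonneg _) h0.le)
    refine ⟨c', hc'.congr' ?_⟩
    filter_upwards [eventually_gt_atTop R] with r hr
    rw [hB r hr, polyVal_mul, polyVal_X, polyVal_X]
  obtain ⟨a, ha⟩ := key 0 0
  obtain ⟨b, hb⟩ := key 0 1
  obtain ⟨b', hb'⟩ := key 1 0
  obtain ⟨d, hd⟩ := key 1 1
  have hn : ∀ᶠ r in atTop, ‖σ r‖ = r := by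
    filter_upwards [eventually_gt_atTop R] with r hr using hσ.norm_eq r hr
  have had : a + d = 1 := by
    refine tendsto_nhds_unique (ha.add hd) (tendsto_const_nhds.congr' ?_)
    filter_upwards [eventually_gt_atTop R] with r hr
    have h1 := norm_sq_plane (σ r)
    have h0 : 0 < r := hR.trans_lt hr
    rw [hσ.norm_eq r hr] at h1
    field_simp
    linarith
  by_cases ha0 : a = 0
  · exact exists_tendsto_toRP2 1 hn hb' hd (by simp; intro h; simp [ha0, h] at had)
  · exact exists_tendsto_toRP2 0 hn ha hb (by simpa using ha0)

/-! ### Signs next to a tangency -/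

lemma hasSideSigns_of_hasDerivAt {u : ℝ → ℝ} {u' t : ℝ} (hu : HasDerivAt u u' t) (h0 : u t = 0)
    (hu' : u' ≠ 0) : HasSideSigns u t (-SignType.sign u') (SignType.sign u') := by
  have key : ∀ {u : ℝ → ℝ} {u' : ℝ}, HasDerivAt u u' t → u t = 0 → 0 < u' →
      HasSideSigns u t (-1) 1 := by
    intro u u' hu h0 hu'
    have h1 : ∀ᶠ s in 𝓝[≠] t, 0 < slope u t s :=
      (hasDerivAt_iff_tendsto_slope.1 hu).eventually (lt_mem_nhds hu')
    have hlt : 𝓝[<] t ≤ 𝓝[≠] t := nhdsLT_sup_nhdsGT t ▸ le_sup_left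
    have hgt : 𝓝[>] t ≤ 𝓝[≠] t := nhdsLT_sup_nhdsGT t ▸ le_sup_right
    refine ⟨by decide, by decide, ?_, ?_⟩
    · filter_upwards [hlt h1, self_mem_nhdsWithin] with s hs hst
      have hst' : s - t < 0 := sub_neg.2 hst
      rw [slope_def_field, h0, sub_zero] at hs
      exact sign_neg (by by_contra! hc; exact absurd hs (not_lt.2 (div_nonpos_of_nonneg_of_nonpos hc hst'.le)))
    · filter_upwards [hgt h1, self_mem_nhdsWithin] with s hs hst
      have hst' : 0 < s - t := sub_pos.2 hst
      rw [slope_def_field, h0, sub_zero] at hs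
      exact sign_pos (by by_contra! hc; exact absurd hs (not_lt.2 (div_nonpos_of_nonpos_of_nonneg hc hst'.le)))
  rcases hu'.lt_or_gt with h | h
  · rw [sign_neg h]
    have := (key hu.neg (by simp [h0]) (neg_pos.2 h)).neg
    simpa using this
  · rw [sign_pos h]
    exact key hu h0 h

lemma HasSideSigns.pow_mul {u v : ℝ → ℝ} {t : ℝ} {sL sR : SignType} (hu : HasSideSigns u t sL sR)
    (m : ℕ) (hv : ContinuousAt v t) (hvt : v t ≠ 0) :
    HasSideSigns (fun s => u s ^ m * v s) t (sL ^ m * SignType.sign (v t))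
      (sR ^ m * SignType.sign (v t)) := by
  have h1 : ∀ᶠ s in 𝓝 t, SignType.sign (v s) = SignType.sign (v t) := by
    rcases hvt.lt_or_gt with h | h
    · filter_upwards [hv.eventually (gt_mem_nhds h)] with s hs
      rw [sign_neg h, sign_neg hs]
    · filter_upwards [hv.eventually (lt_mem_nhds h)] with s hs
      rw [sign_pos h, sign_pos hs]
  refine ⟨mul_ne_zero (pow_ne_zero _ hu.left_ne) (sign_ne_zero.2 hvt),
    mul_ne_zero (pow_ne_zero _ hu.right_ne) (sign_ne_zero.2 hvt), ?_, ?_⟩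
  · filter_upwards [hu.left, nhdsWithin_le_nhds h1] with s h2 h3
    rw [sign_mul, sign_pow, h2, h3]
  · filter_upwards [hu.right, nhdsWithin_le_nhds h1] with s h2 h3
    rw [sign_mul, sign_pow, h2, h3]

/-- By transversality `h` has a simple zero along the circle, so the side signs of `h ^ m * V` are
those of the derivative of `h`, to the power `m`, times the sign of `V`. -/
lemma hasSideSigns_tangencyPoly {f h V : MvPolynomial (Fin 2) ℝ} {m : ℕ}
    (hfac : tangencyPoly f = h ^ m * V) {r t : ℝ} (h0 : polyVal h (circlePoint r t) = 0)
    (hD : polyVal (tangencyPoly h) (circlePoint r t) ≠ 0)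
    (hV : polyVal V (circlePoint r t) ≠ 0) :
    HasSideSigns (fun s => polyVal (tangencyPoly f) (circlePoint r s)) t
      ((-SignType.sign (polyVal (tangencyPoly h) (circlePoint r t))) ^ m *
        SignType.sign (polyVal V (circlePoint r t)))
      (SignType.sign (polyVal (tangencyPoly h) (circlePoint r t)) ^ m *
        SignType.sign (polyVal V (circlePoint r t))) := by
  have := (hasSideSigns_of_hasDerivAt (hasDerivAt_polyVal_circlePoint h r t) h0 hD).pow_mul m
    (hasDerivAt_polyVal_circlePoint V r t).continuousAt hV
  simpa [hfac] using this

lemma sign_eq_of_ne_zero {u : ℝ → ℝ} {s : Set ℝ} (hs : IsPreconnected s) (hu : ContinuousOn u s)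
    (h0 : ∀ x ∈ s, u x ≠ 0) {x y : ℝ} (hx : x ∈ s) (hy : y ∈ s) :
    SignType.sign (u x) = SignType.sign (u y) := by
  have key : ∀ x ∈ s, ∀ y ∈ s, u x < 0 → 0 < u y → False := by
    intro x hx y hy h1 h2
    obtain ⟨z, hz, hz'⟩ := hs.intermediate_value hx hy hu ⟨h1.le, h2.le⟩
    exact h0 z hz hz'
  rcases (h0 x hx).lt_or_gt with h1 | h1 <;> rcases (h0 y hy).lt_or_gt with h2 | h2
  · rw [sign_neg h1, sign_neg h2]
  · exact (key x hx y hy h1 h2).elim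
  · exact (key y hy x hx h2 h1).elim
  · rw [sign_pos h1, sign_pos h2]

/-! ### The curve of tangencies far from the origin -/

/-- A radius beyond which the irreducible components of the curve of tangencies are smooth,
disjoint from each other and transverse to the circles about the origin. -/
structure IsRegularRadius (f : MvPolynomial (Fin 2) ℝ) (S : Finset (MvPolynomial (Fin 2) ℝ))
    (R : ℝ) : Prop where
  nonneg : 0 ≤ R
  isTransverse : ∀ h ∈ S, IsTransverse h R
  disjoint : ∀ h ∈ S, ∀ h' ∈ S, h ≠ h' → ∀ q : Plane, R < ‖q‖ → polyVal h q = 0 → polyVal h' q ≠ 0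
  radial_ne : ∀ h ∈ S, ∀ q : Plane, R < ‖q‖ → polyVal h q = 0 → polyVal (radialPoly f) q ≠ 0
  cofactor : ∀ h ∈ S, ∃ (m : ℕ) (V : MvPolynomial (Fin 2) ℝ), tangencyPoly f = h ^ m * V ∧
    ∀ q : Plane, R < ‖q‖ → polyVal h q = 0 → polyVal V q ≠ 0

/-- If `h` divided both `T` and `E`, its zeros away from the origin would be critical points of `f`;
a zero far out lies on an arc of them and is not isolated. -/
lemma eventually_radialPoly_ne_zero {f h : MvPolynomial (Fin 2) ℝ}
    (hf : HasIsolatedCriticalPoints f) (hh : Irreducible h) (hT : h ∣ tangencyPoly f) :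
    ∀ᶠ R in atTop, ∀ q : Plane, R < ‖q‖ → polyVal h q = 0 → polyVal (radialPoly f) q ≠ 0 := by
  by_cases hE : h ∣ radialPoly f
  · filter_upwards [eventually_isTransverse hh, eventually_ge_atTop 0] with R hR hR0 q hq hq0
    exfalso
    have hcrit : ∀ q : Plane, 0 < ‖q‖ → polyVal h q = 0 → q ∈ critSet f := by
      intro q hq hq0
      rw [mem_critSet_iff (norm_pos_iff.1 hq)]
      obtain ⟨a, ha⟩ := hT
      obtain ⟨b, hb⟩ := hE
      rw [ha, hb]
      simp [hq0]
    obtain ⟨σ, hσ, hσq⟩ := hR.exists_isArc hR0 hq hq0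
    have hiso := hf q (hcrit q (hR0.trans_lt hq) hq0)
    rw [eventually_nhdsWithin_iff] at hiso
    have hcont : ContinuousAt σ ‖q‖ := hσ.continuousOn.continuousAt (Ioi_mem_nhds hq)
    have h1 := hcont.eventually (hσq.symm ▸ hiso)
    obtain ⟨r, ⟨h2, h3⟩, h4⟩ := (((h1.and (lt_mem_nhds hq)).filter_mono
      nhdsWithin_le_nhds).and (self_mem_nhdsWithin : ∀ᶠ r in 𝓝[>] ‖q‖, r ∈ Set.Ioi ‖q‖)).exists
    have h4' : ‖q‖ < r := h4
    refine h2 (fun h => ?_) (hcrit _ ?_ (hσ.polyVal_eq r h3))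
    · have h5 : σ r = q := (Set.mem_singleton_iff.1 h).trans hσq
      have h6 := hσ.norm_eq r h3
      rw [h5] at h6
      linarith
    · rw [hσ.norm_eq r h3]
      exact hR0.trans_lt h3
  · exact eventually_ne_zero_of_not_dvd hh hE

lemma exists_irreducible_factors {T : MvPolynomial (Fin 2) ℝ} (hT : T ≠ 0) :
    ∃ S : Finset (MvPolynomial (Fin 2) ℝ), (∀ h ∈ S, Irreducible h) ∧ (∀ h ∈ S, h ∣ T) ∧
      (∀ h ∈ S, ∀ h' ∈ S, h ∣ h' → h = h') ∧
      ∀ q, polyVal T q = 0 ↔ ∃ h ∈ S, polyVal h q = 0 := by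
  classical
  -- Normalization selects one representative of each class of associates, so that distinct members
  -- of `S` do not divide each other.
  let _ : StrongNormalizationMonoid (MvPolynomial (Fin 2) ℝ) :=
    UniqueFactorizationMonoid.strongNormalizationMonoid
  refine ⟨(UniqueFactorizationMonoid.normalizedFactors T).toFinset, fun h hh => ?_, fun h hh => ?_,
    fun h hh h' hh' hd => ?_, fun q => ?_⟩
  · exact UniqueFactorizationMonoid.irreducible_of_normalized_factor h (Multiset.mem_toFinset.1 hh)
  · exact UniqueFactorizationMonoid.dvd_of_mem_normalizedFactors (Multiset.mem_toFinset.1 hh)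
  · rw [Multiset.mem_toFinset] at hh hh'
    have h1 := UniqueFactorizationMonoid.irreducible_of_normalized_factor h hh
    have h2 := UniqueFactorizationMonoid.irreducible_of_normalized_factor h' hh'
    have h3 := h1.associated_of_dvd h2 hd
    rw [← UniqueFactorizationMonoid.normalize_normalized_factor h hh,
      ← UniqueFactorizationMonoid.normalize_normalized_factor h' hh']
    exact normalize_eq_normalize_iff_associated.2 h3
  · have h1 := (UniqueFactorizationMonoid.prod_normalizedFactors hT)
    have h2 := h1.map (MvPolynomial.eval fun k => q k)
    have h3 : polyVal T q = 0 ↔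
        MvPolynomial.eval (fun k => q k) (UniqueFactorizationMonoid.normalizedFactors T).prod = 0 :=
      h2.eq_zero_iff.symm
    rw [h3, map_multiset_prod, Multiset.prod_eq_zero_iff, Multiset.mem_map]
    simp only [Multiset.mem_toFinset]
    rfl

theorem exists_isRegularRadius {f : MvPolynomial (Fin 2) ℝ} (hf : HasIsolatedCriticalPoints f)
    (hT : tangencyPoly f ≠ 0) :
    ∃ S : Finset (MvPolynomial (Fin 2) ℝ), (∀ h ∈ S, Irreducible h) ∧
      (∀ q, polyVal (tangencyPoly f) q = 0 ↔ ∃ h ∈ S, polyVal h q = 0) ∧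
      ∃ R, IsRegularRadius f S R := by
  obtain ⟨S, hirr, hdvd, hdisj, hzero⟩ := exists_irreducible_factors hT
  refine ⟨S, hirr, hzero, ?_⟩
  have h1 : ∀ᶠ R in atTop, ∀ h ∈ S, IsTransverse h R :=
    (Filter.eventually_all_finset S).2 fun h hh => eventually_isTransverse (hirr h hh)
  have h2 : ∀ᶠ R in atTop, ∀ h ∈ S, ∀ h' ∈ S, h ≠ h' → ∀ q : Plane, R < ‖q‖ →
      polyVal h q = 0 → polyVal h' q ≠ 0 := by
    refine (Filter.eventually_all_finset S).2 fun h hh => (Filter.eventually_all_finset S).2 fun h' hh' => ?_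
    by_cases hne : h = h'
    · simp [hne]
    · have := eventually_ne_zero_of_not_dvd (hirr h hh) fun hd => hne (hdisj h hh h' hh' hd)
      exact this.mono fun R hR _ => hR
  have h3 : ∀ᶠ R in atTop, ∀ h ∈ S, ∀ q : Plane, R < ‖q‖ → polyVal h q = 0 →
      polyVal (radialPoly f) q ≠ 0 :=
    (Filter.eventually_all_finset S).2 fun h hh => eventually_radialPoly_ne_zero hf (hirr h hh) (hdvd h hh)
  have h4 : ∀ h ∈ S, ∃ (m : ℕ) (V : MvPolynomial (Fin 2) ℝ), tangencyPoly f = h ^ m * V ∧ ¬ h ∣ V := by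
    intro h hh
    obtain ⟨m, V, hV, hmV⟩ := WfDvdMonoid.max_power_factor hT (hirr h hh)
    exact ⟨m, V, hmV, hV⟩
  have h5 : ∀ᶠ R in atTop, ∀ h ∈ S, ∃ (m : ℕ) (V : MvPolynomial (Fin 2) ℝ),
      tangencyPoly f = h ^ m * V ∧ ∀ q : Plane, R < ‖q‖ → polyVal h q = 0 → polyVal V q ≠ 0 := by
    refine (Filter.eventually_all_finset S).2 fun h hh => ?_
    obtain ⟨m, V, hmV, hV⟩ := h4 h hh
    filter_upwards [eventually_ne_zero_of_not_dvd (hirr h hh) hV] with R hR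
    exact ⟨m, V, hmV, hR⟩
  obtain ⟨R, h0, h1, h2, h3, h5⟩ :=
    ((eventually_ge_atTop 0).and (h1.and (h2.and (h3.and h5)))).exists
  exact ⟨R, h0, h1, h2, h3, h5⟩

/-- The curve of tangencies outside the circle of radius `R` as a finite disjoint union of arcs,
with their numbers, limiting values and endpoints. -/
structure ArcSystem (f : MvPolynomial (Fin 2) ℝ) (R : ℝ) (J : Type) where
  arc : J → ℝ → Plane
  number : J → ℚ
  value : J → OnePoint ℝ
  endpoint : J → lineAtInfinity
  continuousOn_arc : ∀ j, ContinuousOn (arc j) (Set.Ioi R)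
  norm_arc : ∀ j, ∀ r > R, ‖arc j r‖ = r
  arc_inj : ∀ i j, ∀ r > R, arc i r = arc j r → i = j
  mem_iff : ∀ q : Plane, R < ‖q‖ → (polyVal (tangencyPoly f) q = 0 ↔ ∃ j, arc j ‖q‖ = q)
  tangencyNumber_arc : ∀ j, ∀ r > R, tangencyNumber f (arc j r) = number j
  tendsto_value : ∀ j, Tendsto (fun r => (polyVal f (arc j r) : OnePoint ℝ)) atTop (𝓝 (value j))
  tendsto_endpoint : ∀ j, Tendsto (fun r => toRP2 (arc j r)) atTop (𝓝 (endpoint j).1)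
  radial_ne : ∀ j, ∀ r > R, polyVal (radialPoly f) (arc j r) ≠ 0
  exists_sides : ∀ r > R, ∀ t, polyVal (tangencyPoly f) (circlePoint r t) = 0 → ∃ sL sR,
      HasSideSigns (fun s => polyVal (tangencyPoly f) (circlePoint r s)) t sL sR

/-- The number is a function of the signs of `radialPoly f`, `tangencyPoly h` and `V`, none of which
vanishes on the connected arc. -/
lemma IsArc.tangencyNumber_eq {f h V : MvPolynomial (Fin 2) ℝ} {R : ℝ} (hR : 0 ≤ R)
    {σ : ℝ → Plane} (hσ : IsArc h R σ) (hh : IsTransverse h R)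
    (hE : ∀ q : Plane, R < ‖q‖ → polyVal h q = 0 → polyVal (radialPoly f) q ≠ 0) {m : ℕ}
    (hfac : tangencyPoly f = h ^ m * V)
    (hV : ∀ q : Plane, R < ‖q‖ → polyVal h q = 0 → polyVal V q ≠ 0) {r s : ℝ} (hr : R < r)
    (hs : R < s) : tangencyNumber f (σ r) = tangencyNumber f (σ s) := by
  have hn : ∀ r > R, R < ‖σ r‖ := fun r hr => by rwa [hσ.norm_eq r hr]
  have key : ∀ r > R, tangencyNumber f (σ r) =
      (SignType.sign (polyVal (radialPoly f) (σ r)) : ℚ) *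
        (((SignType.sign (polyVal (tangencyPoly h) (σ r)) ^ m *
            SignType.sign (polyVal V (σ r)) : SignType) : ℚ) -
          ((-SignType.sign (polyVal (tangencyPoly h) (σ r))) ^ m *
            SignType.sign (polyVal V (σ r)) : SignType)) / 4 := by
    intro r hr
    obtain ⟨t, ht⟩ := exists_circlePoint (σ r)
    rw [hσ.norm_eq r hr] at ht
    have h0 := hσ.polyVal_eq r hr
    have h1 := hh _ (hn r hr) h0
    have h2 := hE _ (hn r hr) h0
    have h3 := hV _ (hn r hr) h0
    rw [← ht] at h0 h1 h2 h3 ⊢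
    exact _root_.tangencyNumber_eq (hR.trans_lt hr) h2 (hasSideSigns_tangencyPoly hfac h0 h1 h3)
  have hsign : ∀ A : MvPolynomial (Fin 2) ℝ, (∀ q : Plane, R < ‖q‖ → polyVal h q = 0 →
      polyVal A q ≠ 0) → SignType.sign (polyVal A (σ r)) = SignType.sign (polyVal A (σ s)) :=
    fun A hA => sign_eq_of_ne_zero isPreconnected_Ioi (hσ.continuousOn_polyVal A)
      (fun x hx => hA _ (hn x hx) (hσ.polyVal_eq x hx)) hr hs
  rw [key r hr, key s hs, hsign _ hE, hsign _ hh, hsign _ hV]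

theorem exists_arcSystem {f : MvPolynomial (Fin 2) ℝ} (hf : HasIsolatedCriticalPoints f)
    (hT : tangencyPoly f ≠ 0) :
    ∃ R ≥ 0, ∃ (J : Type) (_ : Fintype J), Nonempty (ArcSystem f R J) := by
  classical
  obtain ⟨S, hirr, hzero, R, hR⟩ := exists_isRegularRadius hf hT
  -- Arcs are indexed by their points on the circle of radius `R + 1`, which each arc meets exactly
  -- once.
  let J := {q : Plane // polyVal (tangencyPoly f) q = 0 ∧ ‖q‖ = R + 1}
  have hR1 : R < R + 1 := by linarith
  have hJ : Finite J := by
    have hfin : (⋃ h ∈ S, {q : Plane | polyVal h q = 0 ∧ ‖q‖ = R + 1}).Finite :=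
      S.finite_toSet.biUnion fun h hh => finite_setOf_polyVal_norm (hR.isTransverse h hh) hR1
    refine Set.Finite.to_subtype (hfin.subset fun q hq => ?_)
    obtain ⟨h, hh, h0⟩ := (hzero q).1 hq.1
    exact Set.mem_biUnion hh ⟨h0, hq.2⟩
  have harc : ∀ j : J, ∃ h ∈ S, ∃ σ, IsArc h R σ ∧ σ (R + 1) = j.1 := by
    rintro ⟨q, hq, hqn⟩
    obtain ⟨h, hh, h0⟩ := (hzero q).1 hq
    obtain ⟨σ, hσ, hσq⟩ := (hR.isTransverse h hh).exists_isArc hR.nonneg (hqn ▸ hR1) h0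
    exact ⟨h, hh, σ, hσ, (congrArg σ hqn.symm).trans hσq⟩
  choose h hh σ hσ hσj using harc
  choose c hc using fun j => (hσ j).exists_limitValue (hirr _ (hh j)) f
  choose p hpl hp using fun j => (hσ j).exists_endpoint (hirr _ (hh j)) hR.nonneg
  have hsame : ∀ i ∈ S, ∀ i' ∈ S, ∀ q : Plane, R < ‖q‖ → polyVal i q = 0 → polyVal i' q = 0 →
      i = i' := by
    intro i hi i' hi' q hq h1 h2
    by_contra hne
    exact hR.disjoint i hi i' hi' hne q hq h1 h2
  refine ⟨R, hR.nonneg, J, Fintype.ofFinite J, ⟨⟨σ, fun j => tangencyNumber f j.1, c,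
    fun j => ⟨p j, hpl j⟩, fun j => (hσ j).continuousOn, fun j => (hσ j).norm_eq, ?_, ?_, ?_, hc,
    hp, ?_, ?_⟩⟩⟩
  · intro i j r hr hij
    have h1 : h i = h j := hsame _ (hh i) _ (hh j) (σ i r) (by rwa [(hσ i).norm_eq r hr])
      ((hσ i).polyVal_eq r hr) (by rw [hij]; exact (hσ j).polyVal_eq r hr)
    have h2 := (hσ i).eqOn (hR.isTransverse _ (hh i)) (by rw [h1]; exact hσ j) hr hij hR1
    rw [hσj, hσj] at h2
    exact Subtype.ext h2
  · intro q hq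
    rw [hzero]
    constructor
    · rintro ⟨g, hg, h0⟩
      obtain ⟨τ, hτ, hτq⟩ := (hR.isTransverse g hg).exists_isArc hR.nonneg hq h0
      have h1 : R < ‖τ (R + 1)‖ := by rwa [hτ.norm_eq _ hR1]
      let j : J := ⟨τ (R + 1), (hzero _).2 ⟨g, hg, hτ.polyVal_eq _ hR1⟩, hτ.norm_eq _ hR1⟩
      refine ⟨j, ?_⟩
      have h2 : g = h j := hsame _ hg _ (hh j) (τ (R + 1)) h1 (hτ.polyVal_eq _ hR1) (by
        have := (hσ j).polyVal_eq (R + 1) hR1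
        rwa [hσj] at this)
      have h3 := (hσ j).eqOn (hR.isTransverse _ (hh j)) (τ := τ) (by rw [← h2]; exact hτ) hR1
        (hσj j) hq
      rw [h3, hτq]
    · rintro ⟨j, hj⟩
      exact ⟨h j, hh j, by rw [← hj]; exact (hσ j).polyVal_eq _ hq⟩
  · intro j r hr
    obtain ⟨m, V, hfac, hV⟩ := hR.cofactor _ (hh j)
    rw [← hσj j]
    exact (hσ j).tangencyNumber_eq hR.nonneg (hR.isTransverse _ (hh j)) (hR.radial_ne _ (hh j)) hfac
      hV hr hR1
  · intro j r hr
    exact hR.radial_ne _ (hh j) _ (by rwa [(hσ j).norm_eq r hr]) ((hσ j).polyVal_eq r hr)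
  · intro r hr t ht
    obtain ⟨g, hg, h0⟩ := (hzero _).1 ht
    have hn : R < ‖circlePoint r t‖ := by
      rwa [norm_circlePoint, abs_of_pos (hR.nonneg.trans_lt hr)]
    obtain ⟨m, V, hfac, hV⟩ := hR.cofactor g hg
    exact ⟨_, _, hasSideSigns_tangencyPoly hfac h0 (hR.isTransverse g hg _ hn h0) (hV _ hn h0)⟩

/-! ### The ends of the curve of tangencies -/

lemma alongEnd_image_Ioi {σ : ℝ → Plane} {R : ℝ} (hσ : ∀ r > R, ‖σ r‖ = r) :
    alongEnd (σ '' Set.Ioi R) = map σ atTop := by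
  refine le_antisymm (fun s hs => ?_) (le_inf ?_ ?_)
  · obtain ⟨r₀, hr₀⟩ := mem_atTop_sets.1 hs
    have h1 : {q : Plane | r₀ < ‖q‖} ∈ cobounded Plane :=
      tendsto_norm_cobounded_atTop.eventually (eventually_gt_atTop r₀)
    refine mem_inf_of_inter h1 (mem_principal_self _) ?_
    rintro _ ⟨h2, r, hr, rfl⟩
    refine hr₀ r ?_
    have h2 : r₀ < ‖σ r‖ := h2
    rw [hσ r hr] at h2
    exact h2.le
  · refine (tendsto_norm_atTop_iff_cobounded (f := σ)).1 (tendsto_id.congr' ?_)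
    filter_upwards [eventually_gt_atTop R] with r hr using (hσ r hr).symm
  · refine le_principal_iff.2 (mem_map.2 ?_)
    filter_upwards [eventually_gt_atTop R] with r hr using ⟨r, hr, rfl⟩

lemma endNumber_eq {f : MvPolynomial (Fin 2) ℝ} {γ : Set Plane} {m : ℚ} (hγ : γ.Nonempty)
    (h : HasEndNumber f γ m) : endNumber f γ = m := by
  have h1 : ∃ m, HasEndNumber f γ m := ⟨m, h⟩
  obtain ⟨q, hq⟩ := hγ
  rw [endNumber, dif_pos h1, ← h1.choose_spec q hq, h q hq]

namespace ArcSystem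

variable {f : MvPolynomial (Fin 2) ℝ} {R : ℝ} {J : Type} (A : ArcSystem f R J)
include A

lemma norm_le_of_mem_critSet (hR : 0 ≤ R) {q : Plane} (hq : q ∈ critSet f) : ‖q‖ ≤ R := by
  by_contra! h
  have h0 := (mem_critSet_iff (norm_pos_iff.1 (hR.trans_lt h))).1 hq
  obtain ⟨j, hj⟩ := (A.mem_iff q h).1 h0.1
  exact A.radial_ne j ‖q‖ h (by rw [hj]; exact h0.2)

lemma exteriorCurve_eq {R' : ℝ} (hR : R ≤ R') :
    exteriorCurve f R' = ⋃ j, A.arc j '' Set.Ioi R' := by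
  ext q
  simp only [Set.mem_iUnion]
  constructor
  · rintro ⟨h1, h2⟩
    obtain ⟨j, hj⟩ := (A.mem_iff q (hR.trans_lt h2)).1 h1
    exact ⟨j, ‖q‖, h2, hj⟩
  · rintro ⟨j, r, hr, rfl⟩
    have hr' : R < r := hR.trans_lt hr
    have hn := A.norm_arc j r hr'
    refine ⟨(A.mem_iff _ (by rwa [hn])).2 ⟨j, by rw [hn]⟩, ?_⟩
    change R' < ‖A.arc j r‖
    rwa [hn]

/-- Each arc is closed in the exterior curve and there are finitely many disjoint ones, so the map
to the index of the arc is continuous into a discrete space and constant on connected sets. -/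
lemma connectedComponentIn_eq [Finite J] {R' : ℝ} (hR : R ≤ R') (j : J) {r : ℝ} (hr : R' < r) :
    connectedComponentIn (exteriorCurve f R') (A.arc j r) = A.arc j '' Set.Ioi R' := by
  classical
  have hsub : A.arc j '' Set.Ioi R' ⊆ exteriorCurve f R' := by
    rw [A.exteriorCurve_eq hR]; exact Set.subset_iUnion_of_subset j subset_rfl
  have hmem : A.arc j r ∈ A.arc j '' Set.Ioi R' := ⟨r, hr, rfl⟩
  refine Set.Subset.antisymm ?_ (IsPreconnected.subset_connectedComponentIn
    (isPreconnected_Ioi.image _ ((A.continuousOn_arc j).mono (Set.Ioi_subset_Ioi hR))) hmem hsub)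
  let _ : TopologicalSpace J := ⊥
  have : DiscreteTopology J := ⟨rfl⟩
  have hidx : ∀ q : Plane, ∃ i : J, q ∈ exteriorCurve f R' → A.arc i ‖q‖ = q := by
    intro q
    by_cases hq : q ∈ exteriorCurve f R'
    · obtain ⟨i, hi⟩ := (A.mem_iff q (hR.trans_lt hq.2)).1 hq.1
      exact ⟨i, fun _ => hi⟩
    · exact ⟨j, fun h => absurd h hq⟩
  choose idx hidx using hidx
  have hcl : ∀ i, IsClosed {q : exteriorCurve f R' | A.arc i ‖q.1‖ = q.1} := by
    intro i
    refine isClosed_eq ?_ continuous_subtype_val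
    exact (A.continuousOn_arc i).comp_continuous continuous_subtype_val.norm
      fun q => hR.trans_lt q.2.2
  have heq : ∀ (q : exteriorCurve f R') i, A.arc i ‖q.1‖ = q.1 ↔ idx q.1 = i := by
    intro q i
    constructor
    · intro h
      exact A.arc_inj _ _ ‖q.1‖ (hR.trans_lt q.2.2) ((hidx q.1 q.2).trans h.symm)
    · rintro rfl
      exact hidx q.1 q.2
  have hcont : ContinuousOn idx (exteriorCurve f R') := by
    rw [continuousOn_iff_continuous_domRestrict, continuous_iff_isClosed]
    intro s _
    have : (exteriorCurve f R').domRestrict idx ⁻¹' s =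
        ⋃ i ∈ s, {q : exteriorCurve f R' | A.arc i ‖q.1‖ = q.1} := by
      ext q
      simp [heq]
    rw [this]
    exact s.toFinite.isClosed_biUnion fun i _ => hcl i
  intro q hq
  have hqE := connectedComponentIn_subset _ _ hq
  have h1 : idx q = idx (A.arc j r) := isPreconnected_connectedComponentIn.constant
    (hcont.mono (connectedComponentIn_subset _ _)) hq (mem_connectedComponentIn (hsub hmem))
  have h2 : idx (A.arc j r) = j := by
    refine (heq ⟨_, hsub hmem⟩ j).1 ?_
    rw [A.norm_arc j r (hR.trans_lt hr)]
  refine ⟨‖q‖, hqE.2, ?_⟩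
  rw [← h2, ← h1]
  exact hidx q hqE

lemma ends_eq [Finite J] {R' : ℝ} (hR : R ≤ R') :
    ends f R' = Set.range fun j => A.arc j '' Set.Ioi R' := by
  ext γ
  constructor
  · rintro ⟨q, hq, rfl⟩
    rw [A.exteriorCurve_eq hR] at hq
    obtain ⟨j, r, hr, rfl⟩ := Set.mem_iUnion.1 hq
    exact ⟨j, (A.connectedComponentIn_eq hR j hr).symm⟩
  · rintro ⟨j, rfl⟩
    refine ⟨A.arc j (R' + 1), ?_, (A.connectedComponentIn_eq hR j (by linarith)).symm⟩
    rw [A.exteriorCurve_eq hR]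
    exact Set.mem_iUnion.2 ⟨j, R' + 1, by simp, rfl⟩

variable {R' : ℝ} (hR : R ≤ R') (j : J)
include hR

lemma alongEnd_eq : alongEnd (A.arc j '' Set.Ioi R') = map (A.arc j) atTop :=
  alongEnd_image_Ioi fun r hr => A.norm_arc j r (hR.trans_lt hr)

lemma endsAt_iff {p : RP2} : EndsAt (A.arc j '' Set.Ioi R') p ↔ (A.endpoint j).1 = p := by
  rw [EndsAt, A.alongEnd_eq hR, tendsto_map'_iff]
  exact ⟨fun h => tendsto_nhds_unique (A.tendsto_endpoint j) h, fun h => h ▸ A.tendsto_endpoint j⟩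

lemma hasLimitValue_iff {c : OnePoint ℝ} :
    HasLimitValue f (A.arc j '' Set.Ioi R') c ↔ A.value j = c := by
  rw [HasLimitValue, A.alongEnd_eq hR, tendsto_map'_iff]
  exact ⟨fun h => tendsto_nhds_unique (A.tendsto_value j) h, fun h => h ▸ A.tendsto_value j⟩

lemma hasEndNumber : HasEndNumber f (A.arc j '' Set.Ioi R') (A.number j) := by
  rintro _ ⟨r, hr, rfl⟩
  exact A.tangencyNumber_arc j r (hR.trans_lt hr)

lemma injective_image : Function.Injective fun j => A.arc j '' Set.Ioi R' := by
  intro i j hij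
  have h1 : A.arc i (R' + 1) ∈ A.arc j '' Set.Ioi R' := by
    rw [← show A.arc i '' Set.Ioi R' = A.arc j '' Set.Ioi R' from hij]
    exact ⟨R' + 1, by simp, rfl⟩
  obtain ⟨r, hr, hr'⟩ := h1
  have h2 := congrArg norm hr'
  rw [A.norm_arc j r (hR.trans_lt hr), A.norm_arc i (R' + 1) (by linarith)] at h2
  rw [h2] at hr'
  exact A.arc_inj i j (R' + 1) (by linarith) hr'.symm

open Classical in
lemma indexAt_eq [Fintype J] (p : lineAtInfinity) (c : OnePoint ℝ) :
    indexAt f R' p c = ∑ j, if A.endpoint j = p ∧ A.value j = c then A.number j else 0 := by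
  have hset : {γ | γ ∈ ends f R' ∧ EndsAt γ p ∧ HasLimitValue f γ c} =
      (fun j => A.arc j '' Set.Ioi R') '' ((Finset.univ.filter
        fun j => A.endpoint j = p ∧ A.value j = c : Finset J) : Set J) := by
    ext γ
    rw [Set.mem_ofPred_eq, A.ends_eq hR]
    constructor
    · rintro ⟨⟨j, rfl⟩, h1, h2⟩
      exact ⟨j, by simpa [Subtype.ext_iff] using
        ⟨(A.endsAt_iff hR j).1 h1, (A.hasLimitValue_iff hR j).1 h2⟩, rfl⟩
    · rintro ⟨j, hj, rfl⟩
      have hj : A.endpoint j = p ∧ A.value j = c := by simpa using hj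
      exact ⟨⟨j, rfl⟩, (A.endsAt_iff hR j).2 (congrArg Subtype.val hj.1),
        (A.hasLimitValue_iff hR j).2 hj.2⟩
  rw [indexAt, hset, finsum_mem_image (A.injective_image hR).injOn, finsum_mem_coe_finset,
    Finset.sum_filter]
  refine Finset.sum_congr rfl fun j _ => ?_
  rw [endNumber_eq ((Set.nonempty_Ioi (a := R')).image _) (A.hasEndNumber hR j)]

omit hR in
lemma isLargeRadius [Finite J] (hR0 : 0 ≤ R) (hR : R < R') : IsLargeRadius f R' where
  pos := hR0.trans_lt hR
  crit q hq := (A.norm_le_of_mem_critSet hR0 hq).trans_lt hR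
  finite_ends := by rw [A.ends_eq hR.le]; exact Set.finite_range _
  unbounded γ hγ hb := by
    rw [A.ends_eq hR.le] at hγ
    obtain ⟨j, rfl⟩ := hγ
    obtain ⟨K, hK⟩ := hb.exists_norm_le
    have h1 : R' < max K R' + 1 := by linarith [le_max_right K R']
    have h2 := hK (A.arc j (max K R' + 1)) ⟨_, h1, rfl⟩
    rw [A.norm_arc j _ (hR.trans h1)] at h2
    linarith [le_max_left K R']
  arc _ γ hγ r hr := by
    rw [A.ends_eq hR.le] at hγ
    obtain ⟨j, rfl⟩ := hγ
    refine ⟨A.arc j r, ⟨⟨r, hr, rfl⟩, A.norm_arc j r (hR.trans hr)⟩, ?_⟩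
    rintro _ ⟨⟨s, hs, rfl⟩, h⟩
    rw [A.norm_arc j s (hR.trans hs)] at h
    rw [h]
  number γ hγ := by
    rw [A.ends_eq hR.le] at hγ
    obtain ⟨j, rfl⟩ := hγ
    exact ⟨_, A.hasEndNumber hR.le j⟩
  limitValue γ hγ := by
    rw [A.ends_eq hR.le] at hγ
    obtain ⟨j, rfl⟩ := hγ
    exact ⟨_, (A.hasLimitValue_iff hR.le j).2 rfl⟩
  endpoint _ γ hγ := by
    rw [A.ends_eq hR.le] at hγ
    obtain ⟨j, rfl⟩ := hγ
    exact ⟨_, (A.endpoint j).2, (A.endsAt_iff hR.le j).2 rfl⟩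

-- The circle of radius `r` meets each arc in exactly one point, so the sum over its tangencies is
-- the sum over arcs.
omit hR in
lemma index_eq [Fintype J] (hR0 : 0 ≤ R) {r : ℝ} (hr : R < r) {n : ℤ} (H : HasGradIndex f r n) :
    (n : ℚ) = 1 + ∑ j, A.number j := by
  classical
  have hinj : Function.Injective fun j => A.arc j r := fun i j h => A.arc_inj i j r hr h
  rw [H.eq_sum (hR0.trans_lt hr) (Finset.univ.image fun j => A.arc j r) (fun q => ?_)
    (A.exists_sides r hr), Finset.sum_image hinj.injOn]
  · congr 1
    exact Finset.sum_congr rfl fun j _ => A.tangencyNumber_arc j r hr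
  · simp only [Finset.mem_image, Finset.mem_univ, true_and]
    constructor
    · rintro ⟨j, rfl⟩
      have hn := A.norm_arc j r hr
      exact ⟨(A.mem_iff _ (by rwa [hn])).2 ⟨j, by rw [hn]⟩, hn⟩
    · rintro ⟨h1, rfl⟩
      exact (A.mem_iff q hr).1 h1

end ArcSystem

/-! ### Rotation-invariant polynomials -/

section Radial
variable {f : MvPolynomial (Fin 2) ℝ}

lemma polyVal_circlePoint_const (hT : tangencyPoly f = 0) (ρ s t : ℝ) :
    polyVal f (circlePoint ρ s) = polyVal f (circlePoint ρ t) := by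
  refine is_const_of_deriv_eq_zero
    (fun s => (hasDerivAt_polyVal_circlePoint f ρ s).differentiableAt) (fun s => ?_) s t
  rw [(hasDerivAt_polyVal_circlePoint f ρ s).deriv, hT, polyVal_zero]

/-- Here `E` is rotation invariant as well, so a zero of it off the origin would give a whole circle
of critical points. -/
lemma radialPoly_ne_zero_of_tangencyPoly_eq_zero (hf : HasIsolatedCriticalPoints f)
    (hT : tangencyPoly f = 0) {q : Plane} (hq : q ≠ 0) : polyVal (radialPoly f) q ≠ 0 := by
  intro hE
  obtain ⟨t, ht⟩ := exists_circlePoint q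
  have hr : 0 < ‖q‖ := norm_pos_iff.2 hq
  have hTE : tangencyPoly (radialPoly f) = 0 := by
    rw [tangencyPoly_radialPoly, hT]; simp [radialPoly]
  have hcrit : ∀ s, circlePoint ‖q‖ s ∈ critSet f := by
    intro s
    rw [mem_critSet_iff (norm_pos_iff.1 (by rw [norm_circlePoint, abs_norm]; exact hr))]
    refine ⟨by rw [hT, polyVal_zero], ?_⟩
    rw [polyVal_circlePoint_const hTE _ s t, ht, hE]
  have hiso := hf q (ht ▸ hcrit t)
  rw [eventually_nhdsWithin_iff] at hiso
  have hc : Tendsto (fun s => circlePoint ‖q‖ s) (𝓝 t) (𝓝 q) := by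
    have := (continuous_circlePoint.comp (Continuous.prodMk_right ‖q‖)).tendsto t
    simp only [Function.comp_def, ht] at this
    exact this
  obtain ⟨s, h1, h2⟩ := ((eventually_circlePoint_ne (t₀ := t) hr).and
    ((hc.eventually hiso).filter_mono nhdsWithin_le_nhds)).exists
  rw [ht] at h1
  exact h2 h1 (hcrit s)

lemma norm_le_zero_of_mem_critSet (hf : HasIsolatedCriticalPoints f)
    (hT : tangencyPoly f = 0) {q : Plane} (hq : q ∈ critSet f) : ‖q‖ ≤ 0 := by
  by_contra! h
  exact radialPoly_ne_zero_of_tangencyPoly_eq_zero hf hT (norm_pos_iff.1 h)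
    ((mem_critSet_iff (norm_pos_iff.1 h)).1 hq).2

lemma isPreconnected_setOf_lt_norm {R : ℝ} (hR : 0 ≤ R) :
    IsPreconnected {q : Plane | R < ‖q‖} := by
  have h1 : IsPreconnected (Set.Ioi R ×ˢ (Set.univ : Set ℝ)) :=
    isPreconnected_Ioi.prod isPreconnected_univ
  have h2 := h1.image _ continuous_circlePoint.continuousOn
  convert! h2 using 1
  ext q
  constructor
  · intro hq
    obtain ⟨t, ht⟩ := exists_circlePoint q
    exact ⟨(‖q‖, t), ⟨hq, trivial⟩, ht⟩
  · rintro ⟨⟨ρ, t⟩, ⟨hρ, -⟩, rfl⟩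
    have hρ' : R < ρ := hρ
    simpa [norm_circlePoint, abs_of_pos (hR.trans_lt hρ')] using hρ'

lemma exteriorCurve_eq_of_tangencyPoly_eq_zero (hT : tangencyPoly f = 0) (R : ℝ) :
    exteriorCurve f R = {q | R < ‖q‖} := by
  ext q
  simp [exteriorCurve, tangencyCurve, hT]

lemma ends_eq_of_tangencyPoly_eq_zero (hT : tangencyPoly f = 0) {R : ℝ} (hR : 0 ≤ R) :
    ends f R = {{q | R < ‖q‖}} := by
  have key : ∀ q : Plane, R < ‖q‖ →
      connectedComponentIn {q : Plane | R < ‖q‖} q = {q | R < ‖q‖} := fun q hq =>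
    (connectedComponentIn_subset _ _).antisymm
      ((isPreconnected_setOf_lt_norm hR).subset_connectedComponentIn hq subset_rfl)
  ext γ
  rw [ends, exteriorCurve_eq_of_tangencyPoly_eq_zero hT]
  constructor
  · rintro ⟨q, hq, rfl⟩
    exact key q hq
  · rintro rfl
    have hq : R < ‖circlePoint (R + 1) 0‖ := by
      rw [norm_circlePoint, abs_of_pos (by linarith)]; linarith
    exact ⟨_, hq, (key _ hq).symm⟩

lemma alongEnd_setOf_lt_norm (R : ℝ) : alongEnd {q : Plane | R < ‖q‖} = cobounded Plane := by
  rw [alongEnd, inf_eq_left, le_principal_iff]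
  exact tendsto_norm_cobounded_atTop.eventually (eventually_gt_atTop R)

lemma tendsto_circlePoint_cobounded (t : ℝ) :
    Tendsto (fun r => circlePoint r t) atTop (cobounded Plane) := by
  refine tendsto_norm_atTop_iff_cobounded.1 (tendsto_id.congr' ?_)
  filter_upwards [eventually_ge_atTop 0] with r hr
  rw [norm_circlePoint, abs_of_nonneg hr, id]

/-- The upper left entry of the projection matrix vanishes along the `y`-axis but is at least `1/2`
far out on the `x`-axis. -/
lemma not_tendsto_toRP2_cobounded (p : RP2) : ¬ Tendsto toRP2 (cobounded Plane) (𝓝 p) := by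
  intro h
  have h1 : ∀ t, Tendsto (fun r => RP2.toMatrix (toRP2 (circlePoint r t)) 0 0) atTop
      (𝓝 (RP2.toMatrix p 0 0)) := fun t =>
    (((continuous_apply_apply 0 0).comp RP2.continuous_toMatrix).tendsto p).comp
      (h.comp (tendsto_circlePoint_cobounded t))
  have h2 : ∀ r t, RP2.toMatrix (toRP2 (circlePoint r t)) 0 0 =
      (r * Real.cos t) ^ 2 / (r ^ 2 + 1) := by
    intro r t
    rw [toRP2, RP2.toMatrix_mk]
    have : (r * Real.cos t) * (r * Real.cos t) + (r * Real.sin t) * (r * Real.sin t) = r ^ 2 := by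
      linear_combination r ^ 2 * Real.sin_sq_add_cos_sq t
    simp [dotProduct, Fin.sum_univ_three, this, pow_two]
  have h3 : RP2.toMatrix p 0 0 = 0 := by
    refine tendsto_nhds_unique (h1 (Real.pi / 2)) ?_
    simp [h2]
  have h4 : 1 / 2 ≤ RP2.toMatrix p 0 0 := by
    refine ge_of_tendsto (h1 0) ?_
    filter_upwards [eventually_ge_atTop 1] with r hr
    rw [h2, Real.cos_zero, mul_one, div_le_div_iff₀ (by norm_num) (by positivity)]
    nlinarith
  linarith

lemma exists_hasLimitValue_of_tangencyPoly_eq_zero (hT : tangencyPoly f = 0) (R : ℝ) :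
    ∃ c, HasLimitValue f {q | R < ‖q‖} c := by
  -- A rotation-invariant `f` is determined by its values on the positive `x`-axis, which is an arc
  -- of the zero set of the irreducible polynomial `y`.
  have harc : IsArc (X 1) 0 fun r => circlePoint r 0 :=
    ⟨(continuous_circlePoint.comp (Continuous.prodMk_left 0)).continuousOn,
      fun r hr => by rw [norm_circlePoint, abs_of_pos hr], fun r _ => by simp⟩
  obtain ⟨c, hc⟩ := harc.exists_limitValue MvPolynomial.X_prime.irreducible f
  refine ⟨c, ?_⟩
  rw [HasLimitValue, alongEnd_setOf_lt_norm]
  refine (hc.comp tendsto_norm_cobounded_atTop).congr fun q => ?_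
  obtain ⟨t, ht⟩ := exists_circlePoint q
  simp only [Function.comp_apply]
  rw [polyVal_circlePoint_const hT _ 0 t, ht]

lemma isLargeRadius_of_tangencyPoly_eq_zero (hf : HasIsolatedCriticalPoints f)
    (hT : tangencyPoly f = 0) {R : ℝ} (hR : 0 < R) : IsLargeRadius f R where
  pos := hR
  crit q hq := (norm_le_zero_of_mem_critSet hf hT hq).trans_lt hR
  finite_ends := by rw [ends_eq_of_tangencyPoly_eq_zero hT hR.le]; exact Set.finite_singleton _
  unbounded γ hγ hb := by
    rw [ends_eq_of_tangencyPoly_eq_zero hT hR.le, Set.mem_singleton_iff] at hγ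
    obtain ⟨K, hK⟩ := hb.exists_norm_le
    have h1 : R < max K R + 1 := by linarith [le_max_right K R]
    have h3 : ‖circlePoint (max K R + 1) 0‖ = max K R + 1 := by
      rw [norm_circlePoint, abs_of_pos (hR.trans h1)]
    have h2 := hK (circlePoint (max K R + 1) 0) (by
      rw [hγ, Set.mem_ofPred_eq, h3]; exact h1)
    rw [h3] at h2
    linarith [le_max_left K R]
  arc h := absurd hT h
  number γ hγ := by
    rw [ends_eq_of_tangencyPoly_eq_zero hT hR.le, Set.mem_singleton_iff] at hγ
    subst hγ
    refine ⟨0, fun q hq => ?_⟩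
    have hq0 : q ≠ 0 := norm_pos_iff.1 (hR.trans hq)
    exact tangencyNumber_eq_zero_of_tangencyPoly_eq_zero hT hq0
      (radialPoly_ne_zero_of_tangencyPoly_eq_zero hf hT hq0)
  limitValue γ hγ := by
    rw [ends_eq_of_tangencyPoly_eq_zero hT hR.le, Set.mem_singleton_iff] at hγ
    subst hγ
    exact exists_hasLimitValue_of_tangencyPoly_eq_zero hT R
  endpoint h := absurd hT h

lemma indexAt_eq_zero_of_tangencyPoly_eq_zero (hT : tangencyPoly f = 0) {R : ℝ} (hR : 0 ≤ R)
    (p : RP2) (c : OnePoint ℝ) : indexAt f R p c = 0 := by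
  have : {γ | γ ∈ ends f R ∧ EndsAt γ p ∧ HasLimitValue f γ c} = ∅ := by
    refine Set.eq_empty_of_forall_notMem fun γ ⟨h1, h2, _⟩ => ?_
    rw [ends_eq_of_tangencyPoly_eq_zero hT hR, Set.mem_singleton_iff] at h1
    rw [h1, EndsAt, alongEnd_setOf_lt_norm] at h2
    exact not_tendsto_toRP2_cobounded p h2
  rw [indexAt, this, finsum_mem_empty]

end Radial

/-! ### The decomposition of the index -/

lemma exists_hasGradIndex_of_bounded {f : MvPolynomial (Fin 2) ℝ} {R : ℝ}
    (hcrit : ∀ q ∈ critSet f, ‖q‖ ≤ R) :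
    ∃ i : ℤ, ∀ ρ : ℝ, 0 < ρ → (∀ q ∈ critSet f, ‖q‖ < ρ) → HasGradIndex f ρ i := by
  have hcl : IsClosed (critSet f) := by
    have : critSet f = {q | polyVal (pderiv 0 f) q = 0} ∩ {q | polyVal (pderiv 1 f) q = 0} :=
      Set.ext fun q => mem_critSet
    rw [this]
    exact (isClosed_eq (continuous_polyVal _) continuous_const).inter
      (isClosed_eq (continuous_polyVal _) continuous_const)
  have hc : IsCompact (critSet f) :=
    (isCompact_closedBall (0 : Plane) R).of_isClosed_subset hcl fun q hq => by
      simpa using hcrit q hq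
  -- `ρ₀` is the largest norm of a critical point, so that every admissible circle has radius above
  -- `ρ₀`. Inserting `0` covers the case of no critical points.
  obtain ⟨ρ₀, hmem, hmax⟩ := ((hc.image continuous_norm).insert 0).exists_isGreatest
    ⟨0, Set.mem_insert _ _⟩
  obtain ⟨i, hi⟩ := exists_hasGradIndex (f := f) (ρ₀ := ρ₀) (hmax (Set.mem_insert _ _))
    fun q hq => hmax (Set.mem_insert_of_mem _ ⟨q, hq, rfl⟩)
  refine ⟨i, fun ρ hρ h => hi ρ ?_⟩
  rcases hmem with rfl | ⟨q, hq, rfl⟩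
  · exact hρ
  · exact h q hq

/-- Each `j` contributes to at most one `x`, by injectivity of `g`, so the sums may be exchanged. -/
lemma finsum_sum_ite {J X Y : Type*} [Fintype J] [DecidableEq Y] (n : J → ℚ) (e : J → Y) (g : X → Y)
    (hg : Function.Injective g) [DecidablePred (· ∈ Set.range g)] :
    ∑ᶠ x, ∑ j, (if e j = g x then n j else 0) =
      ∑ j, if e j ∈ Set.range g then n j else 0 := by
  rw [finsum_sum_comm]
  · refine Finset.sum_congr rfl fun j _ => ?_
    by_cases hj : e j ∈ Set.range g
    · obtain ⟨x, hx⟩ := hj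
      rw [finsum_eq_single _ x, if_pos hx.symm, if_pos ⟨x, hx⟩]
      exact fun y hy => if_neg fun h => hy (hg (h.symm.trans hx.symm))
    · rw [if_neg hj]
      exact finsum_eq_zero_of_forall_eq_zero fun x => if_neg fun h => hj ⟨x, h.symm⟩
  · intro j _
    refine Set.Subsingleton.finite fun x hx y hy => hg ?_
    have h1 : e j = g x := by by_contra h; simp [h] at hx
    have h2 : e j = g y := by by_contra h; simp [h] at hy
    exact h1.symm.trans h2

theorem mainTheorem3 (f : MvPolynomial (Fin 2) ℝ) (hf : HasIsolatedCriticalPoints f) :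
    ∃ (i : ℤ) (I : lineAtInfinity → OnePoint ℝ → ℚ),
      -- `i` is the index of `grad f` around every circle that contains the critical points
      (∀ ρ : ℝ, 0 < ρ → (∀ q ∈ critSet f, ‖q‖ < ρ) → HasGradIndex f ρ i) ∧
      -- all large circles define the same numbers `i_{p,c}`, called `I p c` here
      (∀ᶠ R in atTop, IsLargeRadius f R ∧
        ∀ (p : lineAtInfinity) (c : OnePoint ℝ), indexAt f R p c = I p c) ∧
      -- only finitely many of them are nonzero
      {x : lineAtInfinity × OnePoint ℝ | I x.1 x.2 ≠ 0}.Finite ∧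
      -- the decomposition of the index
      (i : ℚ) = 1 + ∑ᶠ x : lineAtInfinity × ℝ, I x.1 (x.2 : OnePoint ℝ)
        + ∑ᶠ p : lineAtInfinity, I p OnePoint.infty := by
  classical
  by_cases hT : tangencyPoly f = 0
  · have hcrit : ∀ q ∈ critSet f, ‖q‖ ≤ 0 := fun q hq => norm_le_zero_of_mem_critSet hf hT hq
    obtain ⟨i, hi⟩ := exists_hasGradIndex_of_bounded hcrit
    have hi1 : i = 1 := (hi 1 one_pos fun q hq => (hcrit q hq).trans_lt one_pos).eq_one one_pos hT
    refine ⟨i, fun _ _ => 0, hi, ?_, by simp, by simp [hi1]⟩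
    filter_upwards [eventually_gt_atTop 0] with R hR
    exact ⟨isLargeRadius_of_tangencyPoly_eq_zero hf hT hR,
      fun p c => indexAt_eq_zero_of_tangencyPoly_eq_zero hT hR.le p c⟩
  · obtain ⟨R, hR, J, _, ⟨A⟩⟩ := exists_arcSystem hf hT
    have hcrit : ∀ q ∈ critSet f, ‖q‖ ≤ R := fun q hq => A.norm_le_of_mem_critSet hR hq
    obtain ⟨i, hi⟩ := exists_hasGradIndex_of_bounded hcrit
    let e : J → lineAtInfinity × OnePoint ℝ := fun j => (A.endpoint j, A.value j)
    have he : ∀ j p c, (A.endpoint j = p ∧ A.value j = c) ↔ e j = (p, c) := fun j p c =>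
      Prod.mk_inj.symm
    refine ⟨i, fun p c => ∑ j, if e j = (p, c) then A.number j else 0, hi, ?_, ?_, ?_⟩
    · filter_upwards [eventually_gt_atTop R] with R' hR'
      refine ⟨A.isLargeRadius hR hR', fun p c => ?_⟩
      rw [A.indexAt_eq hR'.le]
      simp only [he]
    · refine (Set.finite_range e).subset fun x hx => ?_
      by_contra hne
      refine hx (Finset.sum_eq_zero fun j _ => if_neg fun h => hne ⟨j, h⟩)
    · have h1 := finsum_sum_ite A.number e (fun x : lineAtInfinity × ℝ => (x.1, (x.2 : OnePoint ℝ)))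
        (fun x y h => by
          simp only [Prod.mk.injEq, OnePoint.coe_eq_coe] at h
          exact Prod.ext h.1 h.2)
      have h2 := finsum_sum_ite A.number e (fun p : lineAtInfinity => (p, (OnePoint.infty : OnePoint ℝ)))
        (fun x y h => (Prod.mk.inj h).1)
      beta_reduce
      rw [A.index_eq hR (lt_add_one R)
        (hi (R + 1) (by linarith) fun q hq => (hcrit q hq).trans_lt (lt_add_one R)), h1, h2,
        add_assoc, ← Finset.sum_add_distrib]
      congr 1
      refine Finset.sum_congr rfl fun j _ => ?_
      rcases h : A.value j with _ | c
      · have hv : A.value j = OnePoint.infty := h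
        simp [e, hv]
      · have hv : A.value j = (c : OnePoint ℝ) := h
        simp [e, hv]

end
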